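/- Let $r\ge 0$, let $X$ be the manifold of complete flags $0\subset V_1\subset\dots\subset V_r\subset\mathbb C^{r+1}$, and let $G=S^1\times SU_{r+1}$ act on $X$ through $SU_{r+1}$. Let $K_G(X)$ be the Grothendieck ring of $G$-equivariant complex vector bundles on $X$, and let $p_i$ $(1\le i\le r)$ be the class of the line bundle $\Lambda^iV_i$ (the Hopf line bundle pulled back by the Plücker embedding); put $p_0=p_{r+1}=1$. Let $\mathbb Q(\Lambda,q)$ be the field of rational functions on the torus of all $(q,\Lambda_0,\dots,\Lambda_r)$ with $\Lambda_0\cdots\Lambda_r=1$, where the coordinates on the maximal torus of $G$ are such that $q$ is the standard character of $S^1$ and the standard representation $\mathbb C^{r+1}$ of $SU_{r+1}$ has character $\Lambda_0^{-1}+\dots+\Lambda_r^{-1}$. Let $\mathcal K=K_G(X)\otimes\mathbb Q(\Lambda,q)$, the tensor product being taken over the representation ring of $G$, which acts on $\mathbb Q(\Lambda,q)$ through characters. Put $Q_i=e^{t_{i-1}-t_i}$ and let $$\hat H_{Q,q}=q^{\partial/\partial t_0}+q^{\partial/\partial t_1}(1-e^{t_0-t_1})+\dots+q^{\partial/\partial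 t_r}(1-e^{t_{r-1}-t_r})$$ be the finite-difference Toda operator, where $q^{\partial/\partial t_j}$ is the translation $t_j\mapsto t_j+\ln q$. For a formal power series $J=\sum_{d\in\mathbb Z_{\ge0}^r}J_dQ^d$ with coefficients in $\mathcal K$ consider the eigenvalue equation $$\hat H_{Q,q}\bigl(p^{\ln Q/\ln q}J\bigr)=(\Lambda_0^{-1}+\dots+\Lambda_r^{-1})\,p^{\ln Q/\ln q}J,\qquad p^{\ln Q/\ln q}=\prod_{i=1}^r p_i^{\ln Q_i/\ln q}.\tag{1}$$ (a) Equation (1) is equivalent to the recursion $$\Bigl[\sum_{j=0}^{r}\frac{p_{j+1}}{p_j}\bigl(q^{d_{j+1}-d_j}-1\bigr)\Bigr]J_d=\sum_{i=1}^{r}\frac{p_{i+1}}{p_i}\,q^{d_{i+1}-d_i}J_{d-\mathbf 1_i}\qquad(d\in\mathbb Z_{\ge0}^r),\tag{2}$$ where $d_0=d_{r+1}=0$, $\mathbf 1_i$ is the $i$-th unit vector, and $J_{d-\mathbf 1_i}=0$ if $d_i=0$. (b) For every $d\ne0$ the factor in square brackets in (2) is invertible in $\mathcal K$, so that (2) determines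 $J_d$ from the coefficients $J_{d-\mathbf 1_i}$. (c) There is exactly one formal power series $J$ with coefficients in $\mathcal K$ which satisfies (1) and $J|_{Q=0}=1$. -/

import Mathlib

open Bundle

set_option linter.unusedSectionVars false

namespace FlagToda

noncomputable section

/-! ## Equivariant vector bundles and the equivariant Grothendieck ring -/

/-- A `G`-equivariant topological complex vector bundle (of constant rank) over a `G`-space `X`:
a family of complex vector spaces with a topology on its total space that is locally isomorphic,
fibrewise linearly, to `U × ℂⁿ`, and a continuous fibrewise linear action of `G` on the total space
covering the action on `X`. -/
structure EquivariantVectorBundle (G X : Type) [Group G] [TopologicalSpace G]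
    [TopologicalSpace X] [MulAction G X] where
  rank : ℕ
  fiber : X → Type
  [addCommGroup : ∀ x, AddCommGroup (fiber x)]
  [module : ∀ x, Module ℂ (fiber x)]
  [topology : TopologicalSpace (TotalSpace (Fin rank → ℂ) fiber)]
  locallyTrivial : ∀ x : X, ∃ e : Trivialization (Fin rank → ℂ) (π (Fin rank → ℂ) fiber),
    x ∈ e.baseSet ∧ e.IsLinear ℂ
  act : ∀ (g : G) (x : X), fiber x →ₗ[ℂ] fiber (g • x)
  act_one : ∀ (x : X) (v : fiber x),
    (⟨(1 : G) • x, act 1 x v⟩ : TotalSpace (Fin rank → ℂ) fiber) = ⟨x, v⟩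
  act_mul : ∀ (g h : G) (x : X) (v : fiber x),
    (⟨(g * h) • x, act (g * h) x v⟩ : TotalSpace (Fin rank → ℂ) fiber) =
      ⟨g • h • x, act g (h • x) (act h x v)⟩
  continuous_act : Continuous fun p : G × TotalSpace (Fin rank → ℂ) fiber =>
    (⟨p.1 • p.2.proj, act p.1 p.2.proj p.2.snd⟩ : TotalSpace (Fin rank → ℂ) fiber)

attribute [instance] EquivariantVectorBundle.addCommGroup EquivariantVectorBundle.module
  EquivariantVectorBundle.topology

namespace EquivariantVectorBundle

section Relations

variable {G X : Type} [Group G] [TopologicalSpace G] [TopologicalSpace X] [MulAction G X]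

/-- The model fibre. -/
abbrev Model (E : EquivariantVectorBundle G X) : Type := Fin E.rank → ℂ

/-- The total space. -/
abbrev Total (E : EquivariantVectorBundle G X) : Type := TotalSpace E.Model E.fiber

/-- `H ≅ E ⊕ F` as equivariant vector bundles. -/
def IsDirectSum (E F H : EquivariantVectorBundle G X) : Prop :=
  ∃ φ : ∀ x, (E.fiber x × F.fiber x) ≃ₗ[ℂ] H.fiber x,
    Continuous (fun v : TotalSpace (E.Model × F.Model) (E.fiber ×ᵇ F.fiber) =>
      (⟨v.proj, φ v.proj v.snd⟩ : H.Total)) ∧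
    ∀ (g : G) (x : X) (v : E.fiber x) (w : F.fiber x),
      φ (g • x) (E.act g x v, F.act g x w) = H.act g x (φ x (v, w))

/-- `H ≅ E ⊗ F` as equivariant vector bundles: there is a continuous equivariant fibrewise bilinear
map which on every fibre is a universal one. -/
def IsTensorProduct (E F H : EquivariantVectorBundle G X) : Prop :=
  ∃ β : ∀ x, E.fiber x →ₗ[ℂ] F.fiber x →ₗ[ℂ] H.fiber x,
    (∀ x, Function.Bijective (TensorProduct.lift (β x))) ∧
    Continuous (fun v : TotalSpace (E.Model × F.Model) (E.fiber ×ᵇ F.fiber) =>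
      (⟨v.proj, β v.proj v.snd.1 v.snd.2⟩ : H.Total)) ∧
    ∀ (g : G) (x : X) (v : E.fiber x) (w : F.fiber x),
      β (g • x) (E.act g x v) (F.act g x w) = H.act g x (β x v w)

end Relations

end EquivariantVectorBundle

section Families

/-! ### Families of linear maps on a finite-dimensional complex vector space

A finite-dimensional complex vector space carries its standard topology, which Mathlib calls the
module topology. -/

variable {W : Type} [AddCommGroup W] [Module ℂ W] [FiniteDimensional ℂ W] [TopologicalSpace W]
  [IsModuleTopology ℂ W]

theorem continuous_coord {ι : Type} [Fintype ι] (b : Module.Basis ι ℂ W) (i : ι) :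
    Continuous fun w : W => b.repr w i :=
  IsModuleTopology.continuous_of_linearMap (b.coord i)

theorem continuous_family_apply {V : Type} [AddCommGroup V] [Module ℂ V] [TopologicalSpace V]
    [IsModuleTopology ℂ V] {Y : Type} [TopologicalSpace Y] {f : Y → W →ₗ[ℂ] V}
    (hf : ∀ w, Continuous fun y => f y w) {u : Y → W} (hu : Continuous u) :
    Continuous fun y => f y (u y) := by
  have := IsModuleTopology.toContinuousAdd ℂ V
  let b := Module.finBasis ℂ W
  have h : (fun y => f y (u y)) = fun y => ∑ i, b.repr (u y) i • f y (b i) := by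
    funext y
    conv_lhs => rw [← b.sum_repr (u y)]
    rw [map_sum]
    exact Finset.sum_congr rfl fun i _ => map_smul _ _ _
  rw [h]
  exact continuous_finsetSum _ fun i _ => ((continuous_coord b i).comp hu).smul (hf (b i))

/-- A pointwise continuous family of linear functionals is continuous. -/
theorem continuous_dual_family [TopologicalSpace (Module.Dual ℂ W)]
    [IsModuleTopology ℂ (Module.Dual ℂ W)] {Y : Type} [TopologicalSpace Y]
    {f : Y → Module.Dual ℂ W} (hf : ∀ w, Continuous fun y => f y w) : Continuous f := by
  have := IsModuleTopology.toContinuousAdd ℂ (Module.Dual ℂ W)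
  let b := Module.finBasis ℂ W
  have h : f = fun y => ∑ i, f y (b i) • b.coord i := by
    funext y
    refine b.ext fun j => ?_
    simp
  rw [h]
  exact continuous_finsetSum _ fun i _ => (hf (b i)).smul continuous_const

theorem continuous_toMatrix {Y : Type} [TopologicalSpace Y] {f : Y → Module.End ℂ W}
    (hf : ∀ w, Continuous fun y => f y w) {ι : Type} [Fintype ι] [DecidableEq ι]
    (b : Module.Basis ι ℂ W) : Continuous fun y => LinearMap.toMatrix b b (f y) := by
  refine continuous_matrix fun i j => ?_
  simp only [LinearMap.toMatrix_apply]
  exact (continuous_coord b i).comp (hf (b j))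

theorem continuous_toLin {Y : Type} [TopologicalSpace Y] {ι : Type} [Fintype ι] [DecidableEq ι]
    (b : Module.Basis ι ℂ W) {M : Y → Matrix ι ι ℂ} (hM : Continuous M) (w : W) :
    Continuous fun y => Matrix.toLin b b (M y) w := by
  have := IsModuleTopology.toContinuousAdd ℂ W
  simp only [Matrix.toLin_apply]
  refine continuous_finsetSum _ fun i _ => Continuous.smul ?_ continuous_const
  exact (continuous_apply i).comp (hM.matrix_mulVec continuous_const)

theorem continuous_det_family {Y : Type} [TopologicalSpace Y] {f : Y → Module.End ℂ W}
    (hf : ∀ w, Continuous fun y => f y w) : Continuous fun y => LinearMap.det (f y) := by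
  let b := Module.finBasis ℂ W
  simp only [← LinearMap.det_toMatrix b]
  exact (continuous_toMatrix hf b).matrix_det

/-- Where a continuous family of endomorphisms is invertible, it has a continuous family of
inverses. -/
theorem exists_continuous_inverse {Y : Type} [TopologicalSpace Y] {f : Y → Module.End ℂ W}
    (hf : ∀ w, Continuous fun y => f y w) (hdet : ∀ y, LinearMap.det (f y) ≠ 0) :
    ∃ f' : Y → Module.End ℂ W, (∀ w, Continuous fun y => f' y w) ∧
      (∀ y w, f' y (f y w) = w) ∧ ∀ y w, f y (f' y w) = w := by
  let b := Module.finBasis ℂ W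
  have hM := continuous_toMatrix hf b
  have hd : ∀ y, IsUnit (LinearMap.toMatrix b b (f y)).det := fun y => by
    rw [LinearMap.det_toMatrix]; exact (hdet y).isUnit
  have hinv : Continuous fun y => (LinearMap.toMatrix b b (f y))⁻¹ := by
    simp only [Matrix.inv_def, Ring.inverse_eq_inv']
    refine Continuous.smul (Continuous.inv₀ hM.matrix_det fun y => (hd y).ne_zero)
      hM.matrix_adjugate
  refine ⟨fun y => Matrix.toLin b b (LinearMap.toMatrix b b (f y))⁻¹,
    fun w => continuous_toLin b hinv w, fun y w => ?_, fun y w => ?_⟩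
  · have h := Matrix.nonsing_inv_mul _ (hd y)
    have h2 := congrArg (Matrix.toLin b b) h
    rw [Matrix.toLin_mul b b b, Matrix.toLin_toMatrix, Matrix.toLin_one] at h2
    exact LinearMap.congr_fun h2 w
  · have h := Matrix.mul_nonsing_inv _ (hd y)
    have h2 := congrArg (Matrix.toLin b b) h
    rw [Matrix.toLin_mul b b b, Matrix.toLin_toMatrix, Matrix.toLin_one] at h2
    exact LinearMap.congr_fun h2 w

end Families

section Subbundles

/-! ### Subbundles of trivial bundles -/

variable {G X : Type} [Group G] [TopologicalSpace G] [TopologicalSpace X] [MulAction G X]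
  {W : Type} [AddCommGroup W] [Module ℂ W] [FiniteDimensional ℂ W] [TopologicalSpace W]
  [IsModuleTopology ℂ W]

/-- The topology of the total space of a family of subspaces of `W`, as a subspace of `X × W`. -/
abbrev subbundleTopology (n : ℕ) (S : X → Submodule ℂ W) :
    TopologicalSpace (TotalSpace (Fin n → ℂ) fun x => S x) :=
  TopologicalSpace.induced (fun v => (v.proj, (v.snd : W))) inferInstance

/-- Local triviality of a family of subspaces that is the image of a continuous family of
idempotents. -/
theorem subbundle_locallyTrivial (n : ℕ) (S : X → Submodule ℂ W) (e : X → Module.End ℂ W)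
    (he : ∀ w, Continuous fun x => e x w) (hS : ∀ x, LinearMap.IsProj (S x) (e x))
    (hn : ∀ x, Module.finrank ℂ (S x) = n) (x₀ : X) :
    letI := subbundleTopology n S
    ∃ t : Trivialization (Fin n → ℂ) (π (Fin n → ℂ) fun x => S x),
      x₀ ∈ t.baseSet ∧ t.IsLinear ℂ := by
  let _ := subbundleTopology n S
  have : IsTopologicalAddGroup W := IsModuleTopology.topologicalAddGroup ℂ W
  have hee : ∀ x w, e x (e x w) = e x w := fun x w => (hS x).map_id _ ((hS x).map_mem w)
  -- `Q x` intertwines `e x₀` and `e x` and is the identity at `x₀`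
  let Q : X → Module.End ℂ W := fun x => e x * e x₀ + (1 - e x) * (1 - e x₀)
  have hQ : ∀ w, Continuous fun x => Q x w := fun w => by
    simp only [Q, LinearMap.add_apply, Module.End.mul_apply, LinearMap.sub_apply,
      Module.End.one_apply, map_sub]
    have h1 := he (e x₀ w)
    have h2 := he w
    fun_prop
  have hQe : ∀ x w, Q x (e x₀ w) = e x (e x₀ w) := fun x w => by simp [Q, hee]
  have heQ : ∀ x w, e x (Q x w) = e x (e x₀ w) := fun x w => by simp [Q, hee]
  have hQ0 : Q x₀ = 1 := by
    ext w; simp [Q, hee]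
  let U : Set X := {x | LinearMap.det (Q x) ≠ 0}
  have hU : IsOpen U := (continuous_det_family hQ).isOpen_preimage _ isOpen_compl_singleton
  obtain ⟨R, hR, hRQ, hQR⟩ := exists_continuous_inverse (Y := U) (f := fun x => Q x)
    (fun w => (hQ w).comp continuous_subtype_val) fun x => x.2
  let R' : X → Module.End ℂ W := fun x => by
    classical exact if h : x ∈ U then R ⟨x, h⟩ else 0
  have hR' : ∀ x (h : x ∈ U), R' x = R ⟨x, h⟩ := fun x h => by simp [R', h]
  let φ : S x₀ ≃ₗ[ℂ] (Fin n → ℂ) := LinearEquiv.ofFinrankEq _ _ (by simp [hn])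
  let p₀ : W →ₗ[ℂ] S x₀ := (e x₀).codRestrict (S x₀) (hS x₀).map_mem
  have hfst : Continuous fun v : TotalSpace (Fin n → ℂ) (fun x => S x) => (v.proj, (v.snd : W)) :=
    continuous_induced_dom
  have hψ : Continuous fun w : W => φ (p₀ w) :=
    IsModuleTopology.continuous_of_linearMap (φ.toLinearMap ∘ₗ p₀)
  have hφ : Continuous fun c : Fin n → ℂ => ((φ.symm c : S x₀) : W) :=
    IsModuleTopology.continuous_of_linearMap ((S x₀).subtype ∘ₗ φ.symm.toLinearMap)
  refine ⟨
    { toFun := fun v => (v.proj, φ (p₀ (R' v.proj v.snd)))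
      invFun := fun q => ⟨q.1, ⟨e q.1 (φ.symm q.2 : S x₀), (hS q.1).map_mem _⟩⟩
      source := TotalSpace.proj ⁻¹' U
      target := U ×ˢ Set.univ
      map_source' := fun v hv => ⟨hv, trivial⟩
      map_target' := fun q hq => hq.1
      left_inv' := ?_
      right_inv' := ?_
      open_source := hU.preimage (continuous_fst.comp hfst)
      open_target := hU.prod isOpen_univ
      continuousOn_toFun := ?_
      continuousOn_invFun := ?_
      baseSet := U
      open_baseSet := hU
      source_eq := rfl
      target_eq := rfl
      proj_toFun := fun _ _ => rfl }, ?_, ⟨fun x hx => ?_⟩⟩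
  · rintro ⟨x, v⟩ hv
    have hx : x ∈ U := hv
    have : e x (e x₀ (R ⟨x, hx⟩ (v : W))) = v := by
      rw [← heQ, hQR ⟨x, hx⟩]; exact (hS x).map_id _ v.2
    simp [p₀, hR' x hx, this]
  · rintro ⟨x, c⟩ hc
    have hx : x ∈ U := hc.1
    have h1 : e x₀ (φ.symm c : S x₀) = (φ.symm c : S x₀) := (hS x₀).map_id _ (φ.symm c).2
    have h2 : R' x (e x (φ.symm c : S x₀)) = (φ.symm c : S x₀) := by
      rw [hR' x hx]
      conv_lhs => rw [← h1, ← hQe]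
      rw [hRQ ⟨x, hx⟩, h1]
    have h3 : p₀ ((φ.symm c : S x₀) : W) = φ.symm c := Subtype.ext h1
    simp [h2, h3]
  · refine (continuous_fst.comp hfst).continuousOn.prodMk (hψ.comp_continuousOn ?_)
    rw [continuousOn_iff_continuous_domRestrict]
    have hc := continuous_family_apply (W := W) (V := W)
      (Y := (TotalSpace.proj ⁻¹' U : Set (TotalSpace (Fin n → ℂ) fun x => S x)))
      (f := fun v => R ⟨v.1.proj, v.2⟩) (u := fun v => (v.1.snd : W))
      (fun w => (hR w).comp
        (((continuous_fst.comp hfst).comp continuous_subtype_val).subtype_mk _))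
      ((continuous_snd.comp hfst).comp continuous_subtype_val)
    refine hc.congr fun v => ?_
    simp [hR' _ v.2]
  · refine Continuous.continuousOn (continuous_induced_rng.2 ?_)
    refine continuous_fst.prodMk ?_
    exact continuous_family_apply (W := W) (V := W) (Y := X × (Fin n → ℂ)) (f := fun q => e q.1)
      (fun w => (he w).comp continuous_fst) (hφ.comp continuous_snd)
  · change LinearMap.det (Q x₀) ≠ 0
    simp [hQ0]
  · exact ((φ.toLinearMap ∘ₗ p₀) ∘ₗ (R' x) ∘ₗ (S x).subtype).isLinear

/-- A continuous equivariant family `e x` of idempotents of constant rank of a finite-dimensional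
continuous representation `W` of `G`. -/
structure IdempotentFamily (G X W : Type) [Group G] [TopologicalSpace G] [TopologicalSpace X]
    [MulAction G X] [AddCommGroup W] [Module ℂ W] [TopologicalSpace W] where
  rank : ℕ
  ρ : Representation ℂ G W
  continuous_ρ : ∀ w, Continuous fun g => ρ g w
  e : X → Module.End ℂ W
  continuous_e : ∀ w, Continuous fun x => e x w
  idem : ∀ x w, e x (e x w) = e x w
  finrank_range : ∀ x, Module.finrank ℂ (LinearMap.range (e x)) = rank
  equivariant : ∀ g x w, e (g • x) (ρ g w) = ρ g (e x w)

namespace IdempotentFamily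

theorem isProj (P : IdempotentFamily G X W) (x : X) :
    LinearMap.IsProj (LinearMap.range (P.e x)) (P.e x) :=
  ⟨fun w => ⟨w, rfl⟩, by rintro _ ⟨w, rfl⟩; exact P.idem x w⟩

theorem act_mem (P : IdempotentFamily G X W) (g : G) (x : X) :
    ∀ v ∈ LinearMap.range (P.e x), P.ρ g v ∈ LinearMap.range (P.e (g • x)) := by
  rintro _ ⟨w, rfl⟩
  exact ⟨P.ρ g w, P.equivariant g x w⟩

/-- The subbundle of the trivial bundle `X × W` whose fibre at `x` is the image of `e x`. -/
def bundle [ContinuousSMul G X] (P : IdempotentFamily G X W) : EquivariantVectorBundle G X :=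
  letI := subbundleTopology P.rank fun x => LinearMap.range (P.e x)
  { rank := P.rank
    fiber := fun x => LinearMap.range (P.e x)
    locallyTrivial := subbundle_locallyTrivial P.rank _ P.e P.continuous_e P.isProj P.finrank_range
    act := fun g x => (P.ρ g).restrict (P.act_mem g x)
    act_one := fun x v => by
      have key : ∀ (y : X) (w : LinearMap.range (P.e y)), y = x → (w : W) = v →
          (⟨y, w⟩ : TotalSpace (Fin P.rank → ℂ) fun x => LinearMap.range (P.e x)) = ⟨x, v⟩ := by
        rintro y w rfl hw
        rw [Subtype.ext hw]
      exact key _ _ (one_smul _ _) (by simp)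
    act_mul := fun g h x v => by
      have key : ∀ (y z : X) (w : LinearMap.range (P.e y)) (w' : LinearMap.range (P.e z)),
          y = z → (w : W) = w' →
          (⟨y, w⟩ : TotalSpace (Fin P.rank → ℂ) fun x => LinearMap.range (P.e x)) = ⟨z, w'⟩ := by
        rintro y z w w' rfl hw
        rw [Subtype.ext hw]
      exact key _ _ _ _ (mul_smul _ _ _) (by simp)
    continuous_act := by
      have hfst : Continuous fun v : TotalSpace (Fin P.rank → ℂ)
          (fun x => LinearMap.range (P.e x)) => (v.proj, (v.snd : W)) := continuous_induced_dom
      refine continuous_induced_rng.2 (Continuous.prodMk ?_ ?_)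
      · exact continuous_fst.smul ((continuous_fst.comp hfst).comp continuous_snd)
      · exact continuous_family_apply (W := W) (V := W)
          (Y := G × TotalSpace (Fin P.rank → ℂ) fun x => LinearMap.range (P.e x))
          (f := fun p => P.ρ p.1) (u := fun p => (p.2.snd : W))
          (fun w => (P.continuous_ρ w).comp continuous_fst)
          ((continuous_snd.comp hfst).comp continuous_snd) }

/-- The family of transposes on the dual representation; its image is the dual bundle. -/
def dual [ContinuousInv G] [TopologicalSpace (Module.Dual ℂ W)]
    [IsModuleTopology ℂ (Module.Dual ℂ W)] (P : IdempotentFamily G X W) :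
    IdempotentFamily G X (Module.Dual ℂ W) where
  rank := P.rank
  ρ := P.ρ.dual
  continuous_ρ := fun l => by
    refine continuous_dual_family fun w => ?_
    simp only [Representation.dual_apply, Module.Dual.transpose_apply]
    exact (IsModuleTopology.continuous_of_linearMap l).comp ((P.continuous_ρ w).comp continuous_inv)
  e := fun x => (P.e x).dualMap
  continuous_e := fun l => by
    refine continuous_dual_family fun w => ?_
    exact (IsModuleTopology.continuous_of_linearMap l).comp (P.continuous_e w)
  idem := fun x l => by ext w; simp [P.idem]
  finrank_range := fun x => by
    rw [LinearMap.finrank_range_dualMap_eq_finrank_range, P.finrank_range]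
  equivariant := fun g x l => by
    ext w
    have h := P.equivariant g⁻¹ (g • x) w
    rw [inv_smul_smul] at h
    simp [Representation.dual_apply, Module.Dual.transpose_apply, h]

end IdempotentFamily

end Subbundles

section Trivial

variable {G : Type} (X : Type) [Group G] [TopologicalSpace G] [TopologicalSpace X] [MulAction G X]

/-- The equivariant vector bundle `X × ℂⁿ` given by a continuous representation of `G` on `ℂⁿ`. -/
def trivialBundle [ContinuousSMul G X] {n : ℕ} (ρ : Representation ℂ G (Fin n → ℂ))
    (hρ : ∀ w, Continuous fun g => ρ g w) : EquivariantVectorBundle G X where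
  rank := n
  fiber := Bundle.Trivial X (Fin n → ℂ)
  locallyTrivial := fun x =>
    ⟨Bundle.Trivial.trivialization X (Fin n → ℂ), Set.mem_univ x, inferInstance⟩
  act := fun g _ => ρ g
  act_one := fun x v => by
    refine (Bundle.Trivial.homeomorphProd X (Fin n → ℂ)).injective (Prod.ext (one_smul _ _) ?_)
    change ρ 1 v = v
    simp
  act_mul := fun g h x v => by
    refine (Bundle.Trivial.homeomorphProd X (Fin n → ℂ)).injective (Prod.ext (mul_smul _ _ _) ?_)
    change ρ (g * h) v = ρ g (ρ h v)
    simp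
  continuous_act := by
    have hfst : Continuous fun v : TotalSpace (Fin n → ℂ) (Bundle.Trivial X (Fin n → ℂ)) =>
        ((v.proj, v.snd) : X × (Fin n → ℂ)) :=
      (Bundle.Trivial.homeomorphProd X (Fin n → ℂ)).continuous
    refine (Bundle.Trivial.isInducing_toProd X (Fin n → ℂ)).continuous_iff.2
      (Continuous.prodMk ?_ ?_)
    · exact continuous_fst.smul ((continuous_fst.comp hfst).comp continuous_snd)
    · exact continuous_family_apply (W := Fin n → ℂ) (V := Fin n → ℂ)
        (Y := G × TotalSpace (Fin n → ℂ) (Bundle.Trivial X (Fin n → ℂ)))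
        (f := fun p => ρ p.1) (u := fun p => p.2.snd)
        (fun w => (hρ w).comp continuous_fst)
        ((continuous_snd.comp hfst).comp continuous_snd)

variable (G)

/-- The trivial line bundle with trivial action. -/
def unitBundle [ContinuousSMul G X] : EquivariantVectorBundle G X :=
  trivialBundle X (n := 1) (Representation.trivial ℂ G (Fin 1 → ℂ)) fun w => by
    simpa using continuous_const

end Trivial

section GrothendieckRing

variable (G X : Type) [Group G] [TopologicalSpace G] [TopologicalSpace X] [MulAction G X]
  [ContinuousSMul G X]

/-- The relations `[E ⊕ F] = [E] + [F]`, `[E ⊗ F] = [E] [F]` and `[1] = 1`. -/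
def grothendieckRelations : Set (MvPolynomial (EquivariantVectorBundle G X) ℤ) :=
  {a | ∃ E F H : EquivariantVectorBundle G X, E.IsDirectSum F H ∧
      a = MvPolynomial.X H - (MvPolynomial.X E + MvPolynomial.X F)} ∪
  {a | ∃ E F H : EquivariantVectorBundle G X, E.IsTensorProduct F H ∧
      a = MvPolynomial.X H - MvPolynomial.X E * MvPolynomial.X F} ∪
  {MvPolynomial.X (unitBundle G X) - 1}

/-- The Grothendieck ring `K_G(X)` of `G`-equivariant complex vector bundles over `X`: the
commutative ring generated by the vector bundles, with direct sum as addition and tensor product as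
multiplication. (Isomorphic bundles have the same class because `H ≅ E` means `H ≅ E ⊗ 1`.) -/
def EquivariantK : Type 1 :=
  MvPolynomial (EquivariantVectorBundle G X) ℤ ⧸ Ideal.span (grothendieckRelations G X)

instance : CommRing (EquivariantK G X) :=
  inferInstanceAs (CommRing (MvPolynomial (EquivariantVectorBundle G X) ℤ ⧸
    Ideal.span (grothendieckRelations G X)))

variable {G X}

/-- The projection from the free commutative ring on the vector bundles. -/
def kMk : MvPolynomial (EquivariantVectorBundle G X) ℤ →+* EquivariantK G X :=
  Ideal.Quotient.mk (Ideal.span (grothendieckRelations G X))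

/-- The class of an equivariant vector bundle. -/
def kClass (E : EquivariantVectorBundle G X) : EquivariantK G X :=
  kMk (MvPolynomial.X E)

theorem kClass_tensor {E F H : EquivariantVectorBundle G X} (h : E.IsTensorProduct F H) :
    kClass H = kClass E * kClass F := by
  rw [kClass, kClass, kClass, ← map_mul]
  exact Ideal.Quotient.eq.2 (Ideal.subset_span (Or.inl (Or.inr ⟨E, F, H, h, rfl⟩)))

theorem kClass_unit : kClass (unitBundle G X) = 1 := by
  rw [kClass, ← map_one kMk]
  exact Ideal.Quotient.eq.2 (Ideal.subset_span (Or.inr rfl))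

variable {W : Type} [AddCommGroup W] [Module ℂ W] [FiniteDimensional ℂ W] [TopologicalSpace W]
  [IsModuleTopology ℂ W] [ContinuousInv G] [TopologicalSpace (Module.Dual ℂ W)]
    [IsModuleTopology ℂ (Module.Dual ℂ W)]

/-- A line bundle tensored with its dual is trivial. -/
theorem isTensorProduct_dual (P : IdempotentFamily G X W) (hP : P.rank = 1) :
    P.bundle.IsTensorProduct P.dual.bundle (unitBundle G X) := by
  have := IsModuleTopology.toContinuousAdd ℂ (Module.Dual ℂ W)
  let Φ : W →ₗ[ℂ] Module.Dual ℂ W →ₗ[ℂ] (Fin 1 → ℂ) :=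
    LinearMap.mk₂ ℂ (fun w l _ => l w) (fun _ _ _ => by ext; simp) (fun _ _ _ => by ext; simp)
      (fun _ _ _ => by ext; simp) (fun _ _ _ => by ext; simp)
  refine ⟨fun x => Φ.domRestrict₁₂ (LinearMap.range (P.e x)) (LinearMap.range (P.dual.e x)),
    fun x => ?_, ?_, fun g x v w => ?_⟩
  · let β := Φ.domRestrict₁₂ (LinearMap.range (P.e x)) (LinearMap.range (P.dual.e x))
    change Function.Bijective (TensorProduct.lift β)
    have h1 : Module.finrank ℂ (LinearMap.range (P.e x)) = 1 := by rw [P.finrank_range, hP]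
    have h2 : Module.finrank ℂ (LinearMap.range (P.dual.e x)) = 1 := by
      rw [P.dual.finrank_range]; exact hP
    have hfin : Module.finrank ℂ (TensorProduct ℂ (LinearMap.range (P.e x))
        (LinearMap.range (P.dual.e x))) = Module.finrank ℂ (Fin 1 → ℂ) := by
      rw [Module.finrank_tensorProduct, h1, h2]; simp
    have hsurj : Function.Surjective (TensorProduct.lift β) := by
      have : Nontrivial (LinearMap.range (P.e x)) :=
        Module.nontrivial_of_finrank_pos (R := ℂ) (by omega)
      obtain ⟨v, hv⟩ := exists_ne (0 : LinearMap.range (P.e x))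
      have hv' : (v : W) ≠ 0 := fun h => hv (Subtype.ext h)
      obtain ⟨l, hl⟩ : ∃ l : Module.Dual ℂ W, l v ≠ 0 := by
        by_contra! h
        exact hv' ((Module.forall_dual_apply_eq_zero_iff ℂ (v : W)).1 h)
      have hev : P.e x v = v := (P.isProj x).map_id _ v.2
      intro c
      refine ⟨TensorProduct.tmul ℂ ((c 0 / l v) • v) ⟨P.dual.e x l, l, rfl⟩, ?_⟩
      rw [TensorProduct.lift.tmul]
      funext i
      change l (P.e x ((c 0 / l v) • (v : W))) = c i
      rw [map_smul, hev, map_smul, smul_eq_mul, div_mul_cancel₀ _ hl, Subsingleton.elim i 0]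
    exact ⟨(LinearMap.injective_iff_surjective_of_finrank_eq_finrank hfin).2 hsurj, hsurj⟩
  · refine (Bundle.Trivial.isInducing_toProd X (Fin 1 → ℂ)).continuous_iff.2 ?_
    let _ := subbundleTopology P.rank fun x => LinearMap.range (P.e x)
    let _ := subbundleTopology P.dual.rank fun x => LinearMap.range (P.dual.e x)
    have hv : Continuous fun v : P.bundle.Total =>
        ((v.proj, (LinearMap.range (P.e v.proj)).subtype v.snd) : X × W) := continuous_induced_dom
    have hl : Continuous fun v : P.dual.bundle.Total =>
        ((v.proj, (LinearMap.range (P.dual.e v.proj)).subtype v.snd) :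
          X × Module.Dual ℂ W) := continuous_induced_dom
    have hd := (FiberBundle.Prod.isInducing_diag P.bundle.Model P.bundle.fiber
      P.dual.bundle.Model P.dual.bundle.fiber).continuous
    refine ((continuous_fst.comp hv).comp (continuous_fst.comp hd)).prodMk
      (continuous_pi fun _ => ?_)
    have hv2 := (continuous_snd.comp hv).comp (continuous_fst.comp hd)
    have hl2 := (continuous_snd.comp hl).comp (continuous_snd.comp hd)
    exact continuous_family_apply (W := W) (V := ℂ)
      (Y := TotalSpace (P.bundle.Model × P.dual.bundle.Model)
        (P.bundle.fiber ×ᵇ P.dual.bundle.fiber))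
      (f := fun v => (LinearMap.range (P.dual.e v.proj)).subtype v.snd.2)
      (u := fun v => (LinearMap.range (P.e v.proj)).subtype v.snd.1)
      (fun w => (IsModuleTopology.continuous_of_linearMap
        (LinearMap.applyₗ (R := ℂ) (M₂ := ℂ) w)).comp hl2) hv2
  · obtain ⟨v, hv⟩ := v
    obtain ⟨w, hw⟩ := w
    funext i
    change (P.ρ.dual g w) (P.ρ g v) = w v
    simp [Representation.dual_apply, Module.Dual.transpose_apply]

/-- The class of a line bundle is a unit, with the class of the dual line bundle as inverse. -/
def lineUnit (P : IdempotentFamily G X W) (hP : P.rank = 1) : (EquivariantK G X)ˣ where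
  val := kClass P.bundle
  inv := kClass P.dual.bundle
  val_inv := by rw [← kClass_tensor (isTensorProduct_dual P hP), kClass_unit]
  inv_val := by rw [mul_comm, ← kClass_tensor (isTensorProduct_dual P hP), kClass_unit]

end GrothendieckRing

/-! ## The manifold of complete flags -/

/-- The hermitian space `ℂ^{r+1}`. -/
abbrev Space (r : ℕ) : Type := EuclideanSpace ℂ (Fin (r + 1))

/-- Complete flags `0 = V₀ ⊂ V₁ ⊂ ⋯ ⊂ V_{r+1} = ℂ^{r+1}` with `dim V_i = i`. -/
@[ext]
structure CompleteFlag (r : ℕ) where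
  V : Fin (r + 2) → Submodule ℂ (Space r)
  mono : Monotone V
  finrank_eq : ∀ i, Module.finrank ℂ (V i) = i

/-- The usual topology of the flag manifold: a subspace is recorded by its orthogonal projector. -/
instance (r : ℕ) : TopologicalSpace (CompleteFlag r) :=
  TopologicalSpace.induced (fun x i => (x.V i).starProjection)
    (inferInstance : TopologicalSpace (Fin (r + 2) → (Space r →L[ℂ] Space r)))

theorem continuous_projector (r : ℕ) (i : Fin (r + 2)) :
    Continuous fun x : CompleteFlag r => (x.V i).starProjection :=
  (continuous_apply (A := fun _ => Space r →L[ℂ] Space r) i).comp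
    (continuous_induced_dom (f := fun (x : CompleteFlag r) i => (x.V i).starProjection))

/-- The group `S¹ × SU_{r+1}`. -/
abbrev SymGroup (r : ℕ) : Type := Circle × Matrix.specialUnitaryGroup (Fin (r + 1)) ℂ

instance (r : ℕ) : ContinuousInv (Matrix.specialUnitaryGroup (Fin (r + 1)) ℂ) :=
  ⟨Continuous.subtype_mk (continuous_subtype_val.star) _⟩

/-- The isometry of `ℂ^{r+1}` given by a special unitary matrix. -/
def suIsometry (r : ℕ) :
    Matrix.specialUnitaryGroup (Fin (r + 1)) ℂ →* (Space r ≃ₗᵢ[ℂ] Space r) where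
  toFun g := Unitary.linearIsometryEquiv ⟨Matrix.toEuclideanCLM (n := Fin (r + 1)) (𝕜 := ℂ) g,
    Unitary.map_mem Matrix.toEuclideanCLM (Matrix.specialUnitaryGroup_le_unitaryGroup g.2)⟩
  map_one' := by
    ext v : 1
    change Matrix.toEuclideanCLM (n := Fin (r + 1)) (𝕜 := ℂ) 1 v = v
    rw [map_one]; rfl
  map_mul' g h := by
    ext v : 1
    change Matrix.toEuclideanCLM (n := Fin (r + 1)) (𝕜 := ℂ) (g.1 * h.1) v = _
    rw [map_mul]; rfl

theorem suIsometry_apply (r : ℕ) (g : Matrix.specialUnitaryGroup (Fin (r + 1)) ℂ) (v : Space r) :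
    suIsometry r g v = Matrix.toEuclideanCLM (n := Fin (r + 1)) (𝕜 := ℂ) g v := rfl

theorem continuous_suIsometry (r : ℕ) (v : Space r) :
    Continuous fun g : SymGroup r => suIsometry r g.2 v := by
  simp only [suIsometry_apply]
  have h : Continuous fun A : Matrix (Fin (r + 1)) (Fin (r + 1)) ℂ =>
      Matrix.toEuclideanCLM (n := Fin (r + 1)) (𝕜 := ℂ) A :=
    LinearMap.continuous_of_finiteDimensional
      (Matrix.toEuclideanCLM (n := Fin (r + 1)) (𝕜 := ℂ)).toAlgEquiv.toLinearMap
  exact (h.comp (continuous_subtype_val.comp continuous_snd)).clm_apply continuous_const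

/-- `S¹ × SU_{r+1}` acts on flags through `SU_{r+1}`. -/
instance (r : ℕ) : MulAction (SymGroup r) (CompleteFlag r) where
  smul g x :=
    { V := fun i => (x.V i).map (suIsometry r g.2).toLinearEquiv.toLinearMap
      mono := fun _ _ h => Submodule.map_mono (x.mono h)
      finrank_eq := fun i => by
        rw [← x.finrank_eq i]
        exact LinearEquiv.finrank_map_eq (suIsometry r g.2).toLinearEquiv (x.V i) }
  one_smul x := CompleteFlag.ext (funext fun i => by
    change (x.V i).map (suIsometry r 1).toLinearEquiv.toLinearMap = x.V i
    rw [map_one]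
    exact Submodule.map_id _)
  mul_smul g h x := CompleteFlag.ext (funext fun i => by
    change (x.V i).map (suIsometry r (g.2 * h.2)).toLinearEquiv.toLinearMap =
      ((x.V i).map (suIsometry r h.2).toLinearEquiv.toLinearMap).map
        (suIsometry r g.2).toLinearEquiv.toLinearMap
    rw [map_mul]
    exact Submodule.map_comp _ _ _)

theorem smul_V (r : ℕ) (g : SymGroup r) (x : CompleteFlag r) (i : Fin (r + 2)) :
    (g • x).V i = (x.V i).map (suIsometry r g.2).toLinearEquiv.toLinearMap := rfl

theorem projector_smul (r : ℕ) (g : SymGroup r) (x : CompleteFlag r) (i : Fin (r + 2))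
    (w : Space r) : ((g • x).V i).starProjection w =
      suIsometry r g.2 ((x.V i).starProjection ((suIsometry r g.2).symm w)) := by
  rw [smul_V]
  exact Submodule.starProjection_map_apply (suIsometry r g.2) (x.V i) w

instance (r : ℕ) : IsModuleTopology ℂ (Space r) :=
  IsModuleTopology.iso (EuclideanSpace.equiv (Fin (r + 1)) ℂ).symm

instance (r : ℕ) : ContinuousSMul (SymGroup r) (CompleteFlag r) where
  continuous_smul := by
    refine continuous_induced_rng.2 (continuous_pi fun i => ?_)
    refine continuous_clm_apply.2 fun w => ?_
    have hsymm : ∀ g : SymGroup r, (suIsometry r g.2).symm = suIsometry r g⁻¹.2 := fun g => by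
      rw [Prod.snd_inv, map_inv]; rfl
    simp only [Function.comp_apply, projector_smul, hsymm]
    have h1 : Continuous fun p : SymGroup r × CompleteFlag r =>
        (p.2.V i).starProjection (suIsometry r p.1⁻¹.2 w) :=
      ((continuous_projector r i).comp continuous_snd).clm_apply
        ((continuous_suIsometry r w).comp (continuous_inv.comp continuous_fst))
    exact continuous_family_apply (W := Space r) (V := Space r)
      (f := fun p : SymGroup r × CompleteFlag r => (suIsometry r p.1.2).toLinearEquiv.toLinearMap)
      (fun v => (continuous_suIsometry r v).comp continuous_fst) h1

/-! ## The Hopf line bundles -/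

instance (r n : ℕ) : TopologicalSpace (⋀[ℂ]^n (Space r)) := moduleTopology ℂ _

instance (r n : ℕ) : IsModuleTopology ℂ (⋀[ℂ]^n (Space r)) := ⟨rfl⟩

instance (r n : ℕ) : TopologicalSpace (Module.Dual ℂ (⋀[ℂ]^n (Space r))) := moduleTopology ℂ _

instance (r n : ℕ) : IsModuleTopology ℂ (Module.Dual ℂ (⋀[ℂ]^n (Space r))) := ⟨rfl⟩

/-- Exterior powers of a continuous family are continuous. -/
theorem continuous_exteriorPower_map (r n : ℕ) {Y : Type} [TopologicalSpace Y]
    {f : Y → Space r →ₗ[ℂ] Space r} (hf : ∀ v, Continuous fun y => f y v)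
    (w : ⋀[ℂ]^n (Space r)) : Continuous fun y => exteriorPower.map n (f y) w := by
  have := IsModuleTopology.toContinuousAdd ℂ (⋀[ℂ]^n (Space r))
  have hw : w ∈ Submodule.span ℂ (Set.range (exteriorPower.ιMulti ℂ n (M := Space r))) := by
    rw [exteriorPower.ιMulti_span]; trivial
  induction hw using Submodule.span_induction with
  | mem w hw =>
    obtain ⟨m, rfl⟩ := hw
    let b := Module.finBasis ℂ (Space r)
    have h : (fun y => exteriorPower.map n (f y) (exteriorPower.ιMulti ℂ n m)) = fun y =>
        ∑ s : Fin n → Fin (Module.finrank ℂ (Space r)),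
          (∏ a, b.repr (f y (m a)) (s a)) • exteriorPower.ιMulti ℂ n (fun a => b (s a)) := by
      funext y
      rw [exteriorPower.map_apply_ιMulti]
      have h1 : (f y ∘ m) = fun a => ∑ j, b.repr (f y (m a)) j • b j := by
        funext a; exact (b.sum_repr _).symm
      rw [h1]
      refine (MultilinearMap.map_sum (exteriorPower.ιMulti ℂ n (M := Space r)).toMultilinearMap
        (fun a j => b.repr (f y (m a)) j • b j)).trans ?_
      exact Finset.sum_congr rfl fun s _ => MultilinearMap.map_smul_univ _ _ _
    rw [h]
    refine continuous_finsetSum _ fun s _ => ?_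
    have hc : Continuous fun y => ∏ a, b.repr (f y (m a)) (s a) :=
      continuous_finsetProd _ fun a _ => (continuous_coord b (s a)).comp (hf (m a))
    exact hc.smul continuous_const
  | zero => simpa using continuous_const
  | add u v _ _ hu hv => simp only [map_add]; exact hu.add hv
  | smul c u _ hu => simp only [map_smul]; exact hu.const_smul c

/-- The image of `⋀ⁿ` of the orthogonal projector onto `U` is `⋀ⁿ U ⊂ ⋀ⁿ ℂ^{r+1}`. -/
theorem range_exteriorPower_projector (r n : ℕ) (U : Submodule ℂ (Space r)) :
    LinearMap.range (exteriorPower.map n U.starProjection.toLinearMap) =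
      LinearMap.range (exteriorPower.map n U.subtype) := by
  have h1 : U.starProjection.toLinearMap =
      U.subtype ∘ₗ U.orthogonalProjectionOnto.toLinearMap := rfl
  have h2 : U.subtype = U.starProjection.toLinearMap ∘ₗ U.subtype := by
    ext v : 1
    exact (Submodule.starProjection_mem_subspace_eq_self v).symm
  apply le_antisymm
  · rw [h1, exteriorPower.map_comp]
    exact LinearMap.range_comp_le_range _ _
  · conv_lhs => rw [h2, exteriorPower.map_comp]
    exact LinearMap.range_comp_le_range _ _

/-- The line `⋀^{i+1} V_{i+1} ⊂ ⋀^{i+1} ℂ^{r+1}`, depending on the flag: the Pluecker embedding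
sends the flag to this point of the projective space of `⋀^{i+1} ℂ^{r+1}`. -/
def pluckerFamily (r : ℕ) (i : Fin r) :
    IdempotentFamily (SymGroup r) (CompleteFlag r) (⋀[ℂ]^(i + 1 : ℕ) (Space r)) where
  rank := 1
  ρ :=
    { toFun := fun g => exteriorPower.map _ (suIsometry r g.2).toLinearEquiv.toLinearMap
      map_one' := by
        rw [Prod.snd_one, map_one]
        exact exteriorPower.map_id
      map_mul' := fun g h => by
        rw [Prod.snd_mul, map_mul]
        exact exteriorPower.map_comp _ _ }
  continuous_ρ := fun w => continuous_exteriorPower_map r _ (fun v => continuous_suIsometry r v) w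
  e := fun x => exteriorPower.map _ (x.V i.succ.castSucc).starProjection.toLinearMap
  continuous_e := fun w => continuous_exteriorPower_map r _
    (fun v => (continuous_projector r i.succ.castSucc).clm_apply continuous_const) w
  idem := fun x w => by
    rw [← LinearMap.comp_apply, ← exteriorPower.map_comp]
    congr 2
    ext v : 1
    exact Submodule.starProjection_mem_subspace_eq_self
      ((x.V i.succ.castSucc).orthogonalProjectionOnto v)
  finrank_range := fun x => by
    rw [range_exteriorPower_projector,
      LinearMap.finrank_range_of_inj
        (exteriorPower.map_injective_field (Submodule.injective_subtype _)),
      exteriorPower.finrank_eq, x.finrank_eq]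
    simp
  equivariant := fun g x w => by
    change exteriorPower.map _ _ (exteriorPower.map _ _ w) =
      exteriorPower.map _ _ (exteriorPower.map _ _ w)
    rw [← LinearMap.comp_apply, ← LinearMap.comp_apply, ← exteriorPower.map_comp,
      ← exteriorPower.map_comp]
    congr 2
    ext v : 1
    change ((g • x).V _).starProjection (suIsometry r g.2 v) =
      suIsometry r g.2 ((x.V _).starProjection v)
    rw [projector_smul, LinearIsometryEquiv.symm_apply_apply]

/-- The class in `K_G(X)` of the line bundle `p_{i+1}`, the pull-back of the Hopf line bundle. -/
def hopf (r : ℕ) (i : Fin r) : (EquivariantK (SymGroup r) (CompleteFlag r))ˣ :=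
  lineUnit (pluckerFamily r i) rfl

/-! ## The coefficient ring `K_G(X) ⊗ ℚ(Λ, q)` -/

/-- The field `ℚ(Λ, q)` of rational functions on the torus of all `(q, Λ₀, …, Λ_r)` with
`Λ₀ ⋯ Λ_r = 1`; as free coordinates we take `q`, `Λ₁`, …, `Λ_r`. -/
def TorusField (r : ℕ) : Type := FractionRing (MvPolynomial (Option (Fin r)) ℚ)

instance (r : ℕ) : Field (TorusField r) :=
  inferInstanceAs (Field (FractionRing (MvPolynomial (Option (Fin r)) ℚ)))

instance (r : ℕ) : Algebra (MvPolynomial (Option (Fin r)) ℚ) (TorusField r) :=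
  inferInstanceAs (Algebra _ (FractionRing (MvPolynomial (Option (Fin r)) ℚ)))

instance (r : ℕ) : IsFractionRing (MvPolynomial (Option (Fin r)) ℚ) (TorusField r) :=
  inferInstanceAs (IsFractionRing _ (FractionRing (MvPolynomial (Option (Fin r)) ℚ)))

/-- The function `q`. -/
def qVar (r : ℕ) : TorusField r := 
  algebraMap (MvPolynomial (Option (Fin r)) ℚ) _ (MvPolynomial.X none)

/-- The functions `Λ₀, …, Λ_r`. -/
def lam (r : ℕ) : Fin (r + 1) → TorusField r :=
  Fin.cons (∏ i : Fin r, algebraMap (MvPolynomial (Option (Fin r)) ℚ) (TorusField r) (MvPolynomial.X (some i)))⁻¹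
    fun i => algebraMap (MvPolynomial (Option (Fin r)) ℚ) _ (MvPolynomial.X (some i))

theorem qVar_ne_zero (r : ℕ) : qVar r ≠ 0 := by
  simp [qVar]

/-- The restriction of the character of the representation `ρ` to the maximal torus is
`∑ₖ q^(a k) Λ^(m k)`. The coordinates `Λ` of the maximal torus are the ones for which the standard
representation `ℂ^{r+1}` has character `Λ₀⁻¹ + ⋯ + Λ_r⁻¹`. -/
def HasCharacter (r : ℕ) {n : ℕ} (ρ : Representation ℂ (SymGroup r) (Fin n → ℂ))
    (a : Fin n → ℤ) (m : Fin n → Fin (r + 1) → ℤ) : Prop :=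
  ∀ (g : SymGroup r) (u : Fin (r + 1) → Circle),
    (g.2 : Matrix (Fin (r + 1)) (Fin (r + 1)) ℂ) = Matrix.diagonal (fun j => ((u j)⁻¹ : ℂ)) →
    LinearMap.trace ℂ _ (ρ g) = ∑ k, (g.1 : ℂ) ^ a k * ∏ j, (u j : ℂ) ^ m k j

/-- The relations `[V] ⊗ 1 = 1 ⊗ ch V` for the representations `V` of `G`. -/
def characterRelations (r : ℕ) :
    Set (TensorProduct ℤ (EquivariantK (SymGroup r) (CompleteFlag r)) (TorusField r)) :=
  {b | ∃ (n : ℕ) (ρ : Representation ℂ (SymGroup r) (Fin n → ℂ))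
    (hρ : ∀ w, Continuous fun g => ρ g w) (a : Fin n → ℤ) (m : Fin n → Fin (r + 1) → ℤ),
    HasCharacter r ρ a m ∧
    b = Algebra.TensorProduct.includeLeftRingHom (kClass (trivialBundle (CompleteFlag r) ρ hρ)) -
      Algebra.TensorProduct.includeRight
        (∑ k, qVar r ^ a k * ∏ j, lam r j ^ m k j : TorusField r)}

/-- The ring `K_G(X) ⊗ ℚ(Λ, q)`, the tensor product over the representation ring of `G`, which acts
on `K_G(X)` by tensoring with representations and on `ℚ(Λ, q)` through characters. -/
def CoeffRing (r : ℕ) : Type 1 :=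
  TensorProduct ℤ (EquivariantK (SymGroup r) (CompleteFlag r)) (TorusField r) ⧸
    Ideal.span (characterRelations r)

instance (r : ℕ) : CommRing (CoeffRing r) :=
  inferInstanceAs (CommRing
    (TensorProduct ℤ (EquivariantK (SymGroup r) (CompleteFlag r)) (TorusField r) ⧸
      Ideal.span (characterRelations r)))

/-- The map `K_G(X) → K_G(X) ⊗ ℚ(Λ, q)`. -/
def fromK (r : ℕ) : EquivariantK (SymGroup r) (CompleteFlag r) →+* CoeffRing r :=
  (Ideal.Quotient.mk (Ideal.span (characterRelations r))).comp Algebra.TensorProduct.includeLeftRingHom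

/-- The map `ℚ(Λ, q) → K_G(X) ⊗ ℚ(Λ, q)`. -/
def scalar (r : ℕ) : TorusField r →+* CoeffRing r :=
  (Ideal.Quotient.mk (Ideal.span (characterRelations r))).comp (Algebra.TensorProduct.includeRight :
    TorusField r →ₐ[ℤ] TensorProduct ℤ (EquivariantK (SymGroup r) (CompleteFlag r))
      (TorusField r)).toRingHom

/-- The element `q` as a unit of the coefficient ring. -/
def q (r : ℕ) : (CoeffRing r)ˣ := Units.map (scalar r) (Units.mk0 (qVar r) (qVar_ne_zero r))

/-- The elements `p_1, …, p_r` of the coefficient ring (`p r i` is `p_{i+1}`). -/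
def p (r : ℕ) : Fin r → (CoeffRing r)ˣ := fun i => Units.map (fromK r) (hopf r i)

/-- The eigenvalue `Λ₀⁻¹ + ⋯ + Λ_r⁻¹`. -/
def eigenvalue (r : ℕ) : CoeffRing r := scalar r (∑ j, (lam r j)⁻¹)

/-! ## The finite-difference Toda operator -/

/-- Formal sums `∑_u c(u) u^{ln Q / ln q}`, where `u = (u_1, …, u_r)` runs through the `r`-tuples
of units of the coefficient ring, `u^{ln Q / ln q} = ∏ᵢ u_i^{ln Q_i / ln q}`, and
`Q_i = e^{t_{i-1} - t_i}`. In particular `Q^d` is the term with `u_i = q^{d_i}`. -/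
abbrev FormalSum (r : ℕ) : Type 1 := (Fin r → (CoeffRing r)ˣ) → CoeffRing r

/-- The factor `u_{j+1} / u_j` (with `u_0 = u_{r+1} = 1`) by which `u^{ln Q / ln q}` gets multiplied
under `t_j ↦ t_j + ln q`, that is under `ln Q_{j+1} ↦ ln Q_{j+1} + ln q`,
`ln Q_j ↦ ln Q_j - ln q`. -/
def step {r : ℕ} (u : Fin r → (CoeffRing r)ˣ) (j : Fin (r + 1)) : (CoeffRing r)ˣ :=
  Fin.snoc (α := fun _ => (CoeffRing r)ˣ) u 1 j / Fin.cons (α := fun _ => (CoeffRing r)ˣ) 1 u j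

/-- The translation operator `q^{∂/∂t_j}`. -/
def translate {r : ℕ} (j : Fin (r + 1)) (c : FormalSum r) : FormalSum r :=
  fun u => step u j * c u

/-- Multiplication by `Q_{i+1} = e^{t_i - t_{i+1}}`. -/
def mulQ {r : ℕ} (i : Fin r) (c : FormalSum r) : FormalSum r :=
  fun u => c (u / Pi.mulSingle i (q r))

/-- The finite-difference Toda operator
`q^{∂/∂t_0} + q^{∂/∂t_1} (1 - e^{t_0-t_1}) + ⋯ + q^{∂/∂t_r} (1 - e^{t_{r-1}-t_r})`. -/
def toda {r : ℕ} (c : FormalSum r) : FormalSum r :=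
  translate 0 c + ∑ i : Fin r, translate i.succ (c - mulQ i c)

/-- The `r`-tuple `p q^d = (p_1 q^{d_1}, …, p_r q^{d_r})`. -/
def exponent {r : ℕ} (d : Fin r →₀ ℕ) : Fin r → (CoeffRing r)ˣ := fun i => p r i * q r ^ d i

/-- The vector-series `p^{ln Q / ln q} J = ∑_d J_d (p q^d)^{ln Q / ln q}`. -/
def dressed {r : ℕ} (J : MvPowerSeries (Fin r) (CoeffRing r)) : FormalSum r :=
  fun u => ∑ᶠ d ∈ {d : Fin r →₀ ℕ | exponent d = u}, MvPowerSeries.coeff d J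

/-- `p^{ln Q / ln q} J` is an eigenvector of the finite-difference Toda operator with eigenvalue
`Λ₀⁻¹ + ⋯ + Λ_r⁻¹`. -/
def IsTodaEigenvector {r : ℕ} (J : MvPowerSeries (Fin r) (CoeffRing r)) : Prop :=
  toda (dressed J) = fun u => eigenvalue r * dressed J u

/-- The coefficient `∑_{j=0}^{r} (p_{j+1} / p_j) (q^{d_{j+1} - d_j} - 1)` of `J_d` in the recursion,
with `p_0 = p_{r+1} = 1` and `d_0 = d_{r+1} = 0`. -/
def recursionFactor {r : ℕ} (d : Fin r →₀ ℕ) : CoeffRing r :=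
  ∑ j : Fin (r + 1), ((step (exponent d) j : CoeffRing r) - (step (p r) j : CoeffRing r))

end

end FlagToda

open FlagToda

/-! Write `L_j` for the class of the line bundle `V_{j+1}/V_j`. Its image in the coefficient ring is
`p_{j+1}/p_j` (`step_p`), so both the Toda operator and the recursion factor are expressions in the
`L_j` and `q`.

All relations come from exterior powers. Splitting `V_{j+1}` into `V_j` and a line gives
`[⋀ⁿ⁺¹V_{j+1}] = [⋀ⁿ⁺¹V_j] + [⋀ⁿV_j] L_j` (`wedgeClass_succ`), so `∏(1 + L_j X)` is the generating
polynomial of the classes `[⋀ⁿ ℂ^{r+1}]`. These bundles are trivial and are given by characters,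
hence `∏(1 + L_j X) = ∏(1 + Λ_j⁻¹ X)` over the coefficient ring (`prod_one_add_lineElem`).

The coefficient of `X` says that the eigenvalue is `∑ L_j`. Comparing the terms of exponent `p q^d`
on both sides of the eigenvalue equation then gives the recursion (`isTodaEigenvector_iff`).

For invertibility no localization at fixed points is needed. If the recursion factor were not a
unit, it would vanish in the residue field of some maximal ideal. There the polynomial identity
makes each `L_j` equal to some `Λ_{σ(j)}⁻¹`. The `Λ_k⁻¹` are linearly independent over `ℤ[q]`
(`eq_zero_of_sum_lam_inv`): the identity of the sums forces `σ` to be a permutation, and then the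
vanishing of `∑ Λ_{σ(j)}⁻¹ (q^{d_{j+1}-d_j} - 1)` forces all differences `d_{j+1} - d_j` to be zero,
so `d = 0` (`isUnit_recursionFactor`). Existence and uniqueness follow by induction on the total
degree of `d`. -/

namespace FlagToda

noncomputable section

/-! ### Relations between classes of bundles in `K_G(X)` -/

section Classes

variable {G X : Type} [Group G] [TopologicalSpace G] [TopologicalSpace X] [MulAction G X]
  [ContinuousSMul G X]

theorem kClass_directSum {E F H : EquivariantVectorBundle G X} (h : E.IsDirectSum F H) :
    kClass H = kClass E + kClass F := by
  rw [kClass, kClass, kClass, ← map_add]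
  exact Ideal.Quotient.eq.2 (Ideal.subset_span (Or.inl (Or.inl ⟨E, F, H, h, rfl⟩)))

variable (G X) in
/-- The vector bundle of rank zero. -/
def zeroBundle : EquivariantVectorBundle G X :=
  trivialBundle X (n := 0) (Representation.trivial ℂ G (Fin 0 → ℂ)) fun w => by
    simpa using continuous_const

instance (x : X) : Subsingleton ((zeroBundle G X).fiber x) :=
  inferInstanceAs (Subsingleton (Fin 0 → ℂ))

/-- Isomorphic bundles differ by a summand of rank zero. -/
theorem isDirectSum_zeroBundle {E H : EquivariantVectorBundle G X}
    (φ : ∀ x, E.fiber x ≃ₗ[ℂ] H.fiber x)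
    (hφ : Continuous fun v : E.Total => (⟨v.proj, φ v.proj v.snd⟩ : H.Total))
    (heq : ∀ (g : G) (x : X) (v : E.fiber x), φ (g • x) (E.act g x v) = H.act g x (φ x v)) :
    E.IsDirectSum (zeroBundle G X) H := by
  refine ⟨fun x => LinearEquiv.ofBijective ((φ x).toLinearMap ∘ₗ LinearMap.fst ℂ _ _)
    ⟨?_, ?_⟩, ?_, ?_⟩
  · rintro ⟨v, z⟩ ⟨v', z'⟩ h
    exact Prod.ext ((φ x).injective h) (Subsingleton.elim _ _)
  · intro w
    exact ⟨((φ x).symm w, 0), by simp⟩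
  · exact hφ.comp (continuous_fst.comp (FiberBundle.Prod.isInducing_diag E.Model E.fiber
      (zeroBundle G X).Model (zeroBundle G X).fiber).continuous)
  · intro g x v w
    exact heq g x v

-- The zero bundle is the direct sum of two copies of itself, so its class `c` satisfies `c = c +
-- c`.
variable (G X) in
theorem kClass_zeroBundle : kClass (zeroBundle G X) = 0 := by
  have h := kClass_directSum (isDirectSum_zeroBundle (E := zeroBundle G X) (H := zeroBundle G X)
    (fun x => LinearEquiv.refl ℂ _) continuous_id fun g x v => rfl)
  simpa using h

/-- Isomorphism is not one of the defining relations; a summand of rank zero turns it into a direct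
sum relation. -/
theorem kClass_eq_of_equiv {E H : EquivariantVectorBundle G X}
    (φ : ∀ x, E.fiber x ≃ₗ[ℂ] H.fiber x)
    (hφ : Continuous fun v : E.Total => (⟨v.proj, φ v.proj v.snd⟩ : H.Total))
    (heq : ∀ (g : G) (x : X) (v : E.fiber x), φ (g • x) (E.act g x v) = H.act g x (φ x v)) :
    kClass E = kClass H := by
  have h := kClass_directSum (isDirectSum_zeroBundle φ hφ heq)
  rw [kClass_zeroBundle, add_zero] at h
  exact h.symm

namespace IdempotentFamily

variable {W : Type} [AddCommGroup W] [Module ℂ W] [FiniteDimensional ℂ W] [TopologicalSpace W]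
  [IsModuleTopology ℂ W]

theorem isInducing_bundle (P : IdempotentFamily G X W) :
    Topology.IsInducing (fun v : P.bundle.Total =>
      ((v.proj, (LinearMap.range (P.e v.proj)).subtype v.snd) : X × W)) := ⟨rfl⟩

/-- The bundle of a sum of two orthogonal families of idempotents is the direct sum. -/
theorem kClass_add (P Q R : IdempotentFamily G X W) (hQ : Q.ρ = P.ρ) (hR : R.ρ = P.ρ)
    (he : ∀ x w, P.e x w = Q.e x w + R.e x w) (hQR : ∀ x w, Q.e x (R.e x w) = 0)
    (hRQ : ∀ x w, R.e x (Q.e x w) = 0) :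
    kClass P.bundle = kClass Q.bundle + kClass R.bundle := by
  have := IsModuleTopology.toContinuousAdd ℂ W
  have hmem : ∀ x (v : LinearMap.range (Q.e x) × LinearMap.range (R.e x)),
      ((LinearMap.range (Q.e x)).subtype.coprod (LinearMap.range (R.e x)).subtype) v ∈
        LinearMap.range (P.e x) := by
    rintro x ⟨⟨_, v, rfl⟩, ⟨_, w, rfl⟩⟩
    refine ⟨Q.e x v + R.e x w, ?_⟩
    simp [he, hQR, hRQ, Q.idem, R.idem]
  refine kClass_directSum ⟨fun x => LinearEquiv.ofBijective
    (((LinearMap.range (Q.e x)).subtype.coprod (LinearMap.range (R.e x)).subtype).codRestrict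
      (LinearMap.range (P.e x)) (hmem x)) ⟨?_, ?_⟩, ?_, ?_⟩
  · rw [← LinearMap.ker_eq_bot, LinearMap.ker_eq_bot']
    rintro ⟨⟨_, v, rfl⟩, ⟨_, w, rfl⟩⟩ h
    have h' : Q.e x v + R.e x w = 0 := congrArg Subtype.val h
    have h1 : Q.e x v = 0 := by simpa [hQR, Q.idem] using congrArg (Q.e x) h'
    have h2 : R.e x w = 0 := by simpa [hRQ, R.idem] using congrArg (R.e x) h'
    exact Prod.ext (Subtype.ext h1) (Subtype.ext h2)
  · rintro ⟨_, w, rfl⟩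
    exact ⟨(⟨Q.e x w, w, rfl⟩, ⟨R.e x w, w, rfl⟩), Subtype.ext (he x w).symm⟩
  · refine P.isInducing_bundle.continuous_iff.2 ?_
    have hd := (FiberBundle.Prod.isInducing_diag Q.bundle.Model Q.bundle.fiber
      R.bundle.Model R.bundle.fiber).continuous
    have h1 := Q.isInducing_bundle.continuous.comp (continuous_fst.comp hd)
    have h2 := R.isInducing_bundle.continuous.comp (continuous_snd.comp hd)
    exact (continuous_fst.comp h1).prodMk ((continuous_snd.comp h1).add (continuous_snd.comp h2))
  · rintro g x ⟨v, hv⟩ ⟨w, hw⟩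
    refine Subtype.ext ?_
    change Q.ρ g v + R.ρ g w = P.ρ g (v + w)
    rw [hQ, hR, map_add]

theorem kClass_eq_zero (P : IdempotentFamily G X W) (he : ∀ x w, P.e x w = 0) :
    kClass P.bundle = 0 := by
  simpa using P.kClass_add P P rfl rfl (by simp [he]) (by simp [he]) (by simp [he])

/-- The difference of two families of idempotents, the second of which is dominated by the
first. -/
def diff (P Q : IdempotentFamily G X W) (hρ : Q.ρ = P.ρ) (hPQ : ∀ x w, P.e x (Q.e x w) = Q.e x w)
    (hQP : ∀ x w, Q.e x (P.e x w) = Q.e x w) : IdempotentFamily G X W where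
  rank := P.rank - Q.rank
  ρ := P.ρ
  continuous_ρ := P.continuous_ρ
  e := fun x => P.e x - Q.e x
  continuous_e := fun w => by
    have : IsTopologicalAddGroup W := IsModuleTopology.topologicalAddGroup ℂ W
    exact (P.continuous_e w).sub (Q.continuous_e w)
  idem := fun x w => by simp [hPQ, hQP, P.idem, Q.idem]
  finrank_range := fun x => by
    have h : LinearMap.IsProj (LinearMap.range (P.e x - Q.e x)) (P.e x - Q.e x) :=
      ⟨fun w => ⟨w, rfl⟩, by rintro _ ⟨w, rfl⟩; simp [hPQ, hQP, P.idem, Q.idem]⟩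
    -- The trace of an idempotent is its rank and traces are additive. Characteristic zero brings
    -- this back to `ℕ`, where it also shows that the subtraction of ranks does not truncate.
    have h1 := h.trace
    rw [map_sub, (P.isProj x).trace, (Q.isProj x).trace, P.finrank_range, Q.finrank_range] at h1
    have h2 : (P.rank : ℂ) = ((Module.finrank ℂ (LinearMap.range (P.e x - Q.e x)) + Q.rank : ℕ) : ℂ) := by
      push_cast
      rw [← h1]; ring
    have h3 := Nat.cast_injective h2
    omega
  equivariant := fun g x w => by
    have h := Q.equivariant g x w
    rw [hρ] at h
    simp [P.equivariant, h]

theorem kClass_diff (P Q : IdempotentFamily G X W) (hρ : Q.ρ = P.ρ)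
    (hPQ : ∀ x w, P.e x (Q.e x w) = Q.e x w) (hQP : ∀ x w, Q.e x (P.e x w) = Q.e x w) :
    kClass P.bundle = kClass Q.bundle + kClass (P.diff Q hρ hPQ hQP).bundle :=
  P.kClass_add Q _ hρ rfl (fun x w => by simp [diff]) (fun x w => by simp [diff, hQP, Q.idem])
    (fun x w => by simp [diff, hPQ, Q.idem])

/-- A family of identities gives the trivial bundle. -/
theorem kClass_eq_trivialBundle (P : IdempotentFamily G X W) (he : ∀ x w, P.e x w = w) {n : ℕ}
    (ρ : Representation ℂ G (Fin n → ℂ)) (hρ : ∀ w, Continuous fun g => ρ g w)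
    (φ : W ≃ₗ[ℂ] (Fin n → ℂ)) (hφ : ∀ g w, φ (P.ρ g w) = ρ g (φ w)) :
    kClass P.bundle = kClass (trivialBundle X ρ hρ) := by
  have htop : ∀ x, LinearMap.range (P.e x) = ⊤ := fun x =>
    LinearMap.range_eq_top.2 fun w => ⟨w, he x w⟩
  refine kClass_eq_of_equiv (fun x => (LinearEquiv.ofTop _ (htop x)).trans φ) ?_ ?_
  · refine (Bundle.Trivial.isInducing_toProd X (Fin n → ℂ)).continuous_iff.2 ?_
    have h := P.isInducing_bundle.continuous
    exact (continuous_fst.comp h).prodMk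
      ((IsModuleTopology.continuous_of_linearMap φ.toLinearMap).comp (continuous_snd.comp h))
  · rintro g x ⟨v, hv⟩
    exact hφ g v

/-- An equivariant bilinear map which fibrewise is a tensor product. -/
theorem kClass_mul {W₁ W₂ : Type} [AddCommGroup W₁] [Module ℂ W₁] [FiniteDimensional ℂ W₁]
    [TopologicalSpace W₁] [IsModuleTopology ℂ W₁] [AddCommGroup W₂] [Module ℂ W₂]
    [FiniteDimensional ℂ W₂] [TopologicalSpace W₂] [IsModuleTopology ℂ W₂]
    (P : IdempotentFamily G X W) (Q : IdempotentFamily G X W₁) (R : IdempotentFamily G X W₂)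
    (Φ : W₁ →ₗ[ℂ] W₂ →ₗ[ℂ] W) (hΦ : ∀ g v w, Φ (Q.ρ g v) (R.ρ g w) = P.ρ g (Φ v w))
    (he : ∀ x v w, P.e x (Φ (Q.e x v) (R.e x w)) = Φ (Q.e x v) (R.e x w))
    (hR : R.rank = 1) (hrank : P.rank = Q.rank)
    (hinj : ∀ x v w, R.e x w ≠ 0 → Φ (Q.e x v) (R.e x w) = 0 → Q.e x v = 0) :
    kClass P.bundle = kClass Q.bundle * kClass R.bundle := by
  have hmem : ∀ x (v : LinearMap.range (Q.e x)) (w : LinearMap.range (R.e x)),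
      Φ v w ∈ LinearMap.range (P.e x) := by
    rintro x ⟨_, v, rfl⟩ ⟨_, w, rfl⟩
    exact ⟨_, he x v w⟩
  let β : ∀ x, LinearMap.range (Q.e x) →ₗ[ℂ] LinearMap.range (R.e x) →ₗ[ℂ]
      LinearMap.range (P.e x) := fun x => LinearMap.mk₂ ℂ (fun v w => ⟨Φ v w, hmem x v w⟩)
    (fun _ _ _ => Subtype.ext (by simp)) (fun _ _ _ => Subtype.ext (by simp))
    (fun _ _ _ => Subtype.ext (by simp)) (fun _ _ _ => Subtype.ext (by simp))
  have := IsModuleTopology.toContinuousAdd ℂ W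
  refine kClass_tensor ⟨β, fun x => ?_, ?_, ?_⟩
  · change Function.Bijective (TensorProduct.lift (β x))
    have h2 : Module.finrank ℂ (LinearMap.range (R.e x)) = 1 := by rw [R.finrank_range, hR]
    have hfin : Module.finrank ℂ (TensorProduct ℂ (LinearMap.range (Q.e x))
        (LinearMap.range (R.e x))) = Module.finrank ℂ (LinearMap.range (P.e x)) := by
      rw [Module.finrank_tensorProduct, h2, P.finrank_range, Q.finrank_range, hrank, mul_one]
    have hsurj : Function.Surjective (TensorProduct.lift (β x)) := by
      have : Nontrivial (LinearMap.range (R.e x)) :=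
        Module.nontrivial_of_finrank_pos (R := ℂ) (by omega)
      obtain ⟨⟨_, l, rfl⟩, hl⟩ := exists_ne (0 : LinearMap.range (R.e x))
      have hl' : R.e x l ≠ 0 := fun h => hl (Subtype.ext h)
      -- Tensoring with the nonzero vector `R.e x l` of the line is injective between spaces of
      -- equal dimension, so every vector of the target is the image of a pure tensor.
      have h3 : Function.Injective ((β x).flip ⟨R.e x l, l, rfl⟩) := by
        rw [← LinearMap.ker_eq_bot, LinearMap.ker_eq_bot']
        rintro ⟨_, v, rfl⟩ h
        exact Subtype.ext (hinj x v l hl' (congrArg Subtype.val h))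
      have h4 := (LinearMap.injective_iff_surjective_of_finrank_eq_finrank
        (by rw [P.finrank_range, Q.finrank_range, hrank])).1 h3
      intro u
      obtain ⟨v, hv⟩ := h4 u
      exact ⟨TensorProduct.tmul ℂ v ⟨R.e x l, l, rfl⟩, hv⟩
    exact ⟨(LinearMap.injective_iff_surjective_of_finrank_eq_finrank hfin).2 hsurj, hsurj⟩
  · refine P.isInducing_bundle.continuous_iff.2 ?_
    have hd := (FiberBundle.Prod.isInducing_diag Q.bundle.Model Q.bundle.fiber
      R.bundle.Model R.bundle.fiber).continuous
    have h1 := Q.isInducing_bundle.continuous.comp (continuous_fst.comp hd)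
    have h2 := R.isInducing_bundle.continuous.comp (continuous_snd.comp hd)
    refine (continuous_fst.comp h1).prodMk ?_
    exact continuous_family_apply (W := W₂) (V := W)
      (Y := TotalSpace (Q.bundle.Model × R.bundle.Model) (Q.bundle.fiber ×ᵇ R.bundle.fiber))
      (f := fun v => Φ ((LinearMap.range (Q.e v.proj)).subtype v.snd.1))
      (u := fun v => (LinearMap.range (R.e v.proj)).subtype v.snd.2)
      (fun w => (IsModuleTopology.continuous_of_linearMap (Φ.flip w)).comp
        (continuous_snd.comp h1)) (continuous_snd.comp h2)
  · rintro g x ⟨v, hv⟩ ⟨w, hw⟩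
    exact Subtype.ext (hΦ g v w)

end IdempotentFamily

end Classes

/-! ### Multiplication by a vector in exterior powers -/

section Exterior

variable {M N : Type} [AddCommGroup M] [Module ℂ M] [AddCommGroup N] [Module ℂ N]

/-- Passing to the exterior algebra makes products and contractions available. -/
theorem coe_exteriorPower_map (n : ℕ) (f : M →ₗ[ℂ] N) (ω : ⋀[ℂ]^n M) :
    (exteriorPower.map n f ω : ExteriorAlgebra ℂ N) = ExteriorAlgebra.map f ω := by
  have h : (⋀[ℂ]^n N).subtype ∘ₗ exteriorPower.map n f =
      (ExteriorAlgebra.map f).toLinearMap ∘ₗ (⋀[ℂ]^n M).subtype := by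
    refine exteriorPower.linearMap_ext ?_
    ext m
    simp
  exact LinearMap.congr_fun h ω

/-- Left multiplication by vectors, `⋀ⁿ M × M → ⋀ⁿ⁺¹ M`. -/
def wedgeMul (M : Type) [AddCommGroup M] [Module ℂ M] (n : ℕ) :
    ⋀[ℂ]^n M →ₗ[ℂ] M →ₗ[ℂ] ⋀[ℂ]^(n + 1) M :=
  LinearMap.mk₂ ℂ
    (fun ω v => ⟨ExteriorAlgebra.ι ℂ v * ω, by
      change _ ∈ LinearMap.range (ExteriorAlgebra.ι ℂ (M := M)) ^ (n + 1)
      rw [pow_succ']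
      exact Submodule.mul_mem_mul ⟨v, rfl⟩ ω.2⟩)
    (fun _ _ _ => Subtype.ext (by simp [mul_add])) (fun _ _ _ => Subtype.ext (by simp))
    (fun _ _ _ => Subtype.ext (by simp [add_mul])) (fun _ _ _ => Subtype.ext (by simp))

theorem coe_wedgeMul (n : ℕ) (ω : ⋀[ℂ]^n M) (v : M) :
    (wedgeMul M n ω v : ExteriorAlgebra ℂ M) = ExteriorAlgebra.ι ℂ v * ω := rfl

theorem map_wedgeMul (n : ℕ) (f : M →ₗ[ℂ] N) (ω : ⋀[ℂ]^n M) (v : M) :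
    exteriorPower.map (n + 1) f (wedgeMul M n ω v) = wedgeMul N n (exteriorPower.map n f ω) (f v) :=
  Subtype.ext (by simp [coe_exteriorPower_map, coe_wedgeMul])

/-- Contraction is an antiderivation which on vectors is evaluation of `d`, so it kills every
product of vectors from the range of `f`. -/
theorem contractLeft_map_eq_zero (f : N →ₗ[ℂ] M) (d : Module.Dual ℂ M) (hd : ∀ v, d (f v) = 0)
    (x : ExteriorAlgebra ℂ N) :
    CliffordAlgebra.contractLeft (Q := (0 : QuadraticForm ℂ M)) d (ExteriorAlgebra.map f x) = 0 := by
  induction x using CliffordAlgebra.left_induction with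
  | algebraMap c =>
    rw [AlgHom.commutes]
    exact CliffordAlgebra.contractLeft_algebraMap _ d c
  | add x y hx hy => rw [map_add, map_add, hx, hy, add_zero]
  | ι_mul x m hx =>
    rw [map_mul]
    change CliffordAlgebra.contractLeft (Q := (0 : QuadraticForm ℂ M)) d
      (ExteriorAlgebra.map f (ExteriorAlgebra.ι ℂ m) * ExteriorAlgebra.map f x) = 0
    rw [ExteriorAlgebra.map_apply_ι]
    refine (CliffordAlgebra.contractLeft_ι_mul d (f m) (ExteriorAlgebra.map f x)).trans ?_
    rw [hd, hx, zero_smul, mul_zero, sub_zero]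

/-- Multiplication by a vector `v` is injective on the exterior power of a subspace that is killed
by a functional which does not kill `v`. -/
theorem map_eq_zero_of_wedgeMul_eq_zero (n : ℕ) (f : N →ₗ[ℂ] M) (d : Module.Dual ℂ M)
    (hd : ∀ v, d (f v) = 0) (v : M) (hv : d v ≠ 0) (ω : ⋀[ℂ]^n N)
    (h : wedgeMul M n (exteriorPower.map n f ω) v = 0) : exteriorPower.map n f ω = 0 := by
  have h1 := congrArg Subtype.val h
  rw [coe_wedgeMul, coe_exteriorPower_map] at h1
  -- Contracting `v ∧ f(ω) = 0` with `d` gives `d(v) f(ω) - v ∧ (d ⌟ f(ω)) = 0`, and the second term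
  -- vanishes.
  have h2 := (CliffordAlgebra.contractLeft_ι_mul (Q := (0 : QuadraticForm ℂ M)) d v
    (ExteriorAlgebra.map f ω)).symm.trans
      ((congrArg (CliffordAlgebra.contractLeft (Q := (0 : QuadraticForm ℂ M)) d) h1).trans
        (map_zero _))
  rw [contractLeft_map_eq_zero f d hd, mul_zero, sub_zero] at h2
  exact Subtype.ext ((coe_exteriorPower_map n f ω).trans ((smul_eq_zero.1 h2).resolve_left hv))

end Exterior

/-! ### The tautological bundles, their exterior powers and the line quotients -/

section Flags

theorem starProjection_starProjection_of_le {r : ℕ} {U V : Submodule ℂ (Space r)} (h : U ≤ V)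
    (w : Space r) : U.starProjection (V.starProjection w) = U.starProjection w :=
  DFunLike.congr_fun (Submodule.starProjection_comp_starProjection_of_le h) w

theorem starProjection_starProjection_of_ge {r : ℕ} {U V : Submodule ℂ (Space r)} (h : U ≤ V)
    (w : Space r) : V.starProjection (U.starProjection w) = U.starProjection w :=
  Submodule.starProjection_eq_self_iff.2 (h (Submodule.starProjection_apply_mem _ _))

/-- The subbundle `V_j ⊂ X × ℂ^{r+1}`. -/
def spaceFamily (r : ℕ) (j : Fin (r + 2)) :
    IdempotentFamily (SymGroup r) (CompleteFlag r) (Space r) where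
  rank := j
  ρ :=
    { toFun := fun g => (suIsometry r g.2).toLinearEquiv.toLinearMap
      map_one' := by rw [Prod.snd_one, map_one]; rfl
      map_mul' := fun g h => by rw [Prod.snd_mul, map_mul]; rfl }
  continuous_ρ := fun w => continuous_suIsometry r w
  e := fun x => (x.V j).starProjection.toLinearMap
  continuous_e := fun w => (continuous_projector r j).clm_apply continuous_const
  idem := fun x w => starProjection_starProjection_of_le le_rfl w
  finrank_range := fun x => by
    rw [← x.finrank_eq j]
    exact congrArg (fun U : Submodule ℂ (Space r) => Module.finrank ℂ U)
      (Submodule.range_starProjection (x.V j))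
  equivariant := fun g x w => by
    change ((g • x).V j).starProjection (suIsometry r g.2 w) =
      suIsometry r g.2 ((x.V j).starProjection w)
    rw [projector_smul, LinearIsometryEquiv.symm_apply_apply]

/-- The bundle `⋀ⁿ V_j`, as a subbundle of `X × ⋀ⁿ ℂ^{r+1}`. -/
def wedgeFamily (r n : ℕ) (j : Fin (r + 2)) :
    IdempotentFamily (SymGroup r) (CompleteFlag r) (⋀[ℂ]^n (Space r)) where
  rank := (j : ℕ).choose n
  ρ :=
    { toFun := fun g => exteriorPower.map n ((spaceFamily r j).ρ g)
      map_one' := by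
        rw [map_one]
        exact exteriorPower.map_id
      map_mul' := fun g h => by
        rw [map_mul]
        exact exteriorPower.map_comp _ _ }
  continuous_ρ := fun w => continuous_exteriorPower_map r n (spaceFamily r j).continuous_ρ w
  e := fun x => exteriorPower.map n ((spaceFamily r j).e x)
  continuous_e := fun w => continuous_exteriorPower_map r n (spaceFamily r j).continuous_e w
  idem := fun x w => by
    rw [← LinearMap.comp_apply, ← exteriorPower.map_comp]
    congr 2
    ext v : 1
    exact (spaceFamily r j).idem x v
  finrank_range := fun x => by
    have h := range_exteriorPower_projector r n (x.V j)
    refine (congrArg (fun U : Submodule ℂ (⋀[ℂ]^n (Space r)) => Module.finrank ℂ U) h).trans ?_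
    rw [LinearMap.finrank_range_of_inj
        (exteriorPower.map_injective_field (Submodule.injective_subtype _)),
      exteriorPower.finrank_eq, x.finrank_eq]
  equivariant := fun g x w => by
    change exteriorPower.map _ _ (exteriorPower.map _ _ w) =
      exteriorPower.map _ _ (exteriorPower.map _ _ w)
    rw [← LinearMap.comp_apply, ← LinearMap.comp_apply, ← exteriorPower.map_comp,
      ← exteriorPower.map_comp]
    congr 2
    ext v : 1
    exact (spaceFamily r j).equivariant g x v

/-- The line bundle `V_{j+1} ⊖ V_j`. -/
def lineFamily (r : ℕ) (j : Fin (r + 1)) :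
    IdempotentFamily (SymGroup r) (CompleteFlag r) (Space r) :=
  (spaceFamily r j.succ).diff (spaceFamily r j.castSucc) rfl
    (fun x => starProjection_starProjection_of_ge (x.mono (Fin.castSucc_lt_succ).le))
    (fun x => starProjection_starProjection_of_le (x.mono (Fin.castSucc_lt_succ).le))

theorem lineFamily_rank (r : ℕ) (j : Fin (r + 1)) : (lineFamily r j).rank = 1 := by
  change (j.succ : ℕ) - (j.castSucc : ℕ) = 1
  simp

/-- The class of `⋀ⁿ V_j`. -/
def wedgeClass (r n : ℕ) (j : Fin (r + 2)) : EquivariantK (SymGroup r) (CompleteFlag r) :=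
  kClass (wedgeFamily r n j).bundle

/-- The class of `V_{j+1} / V_j`. -/
def lineClass (r : ℕ) (j : Fin (r + 1)) : EquivariantK (SymGroup r) (CompleteFlag r) :=
  kClass (lineFamily r j).bundle

/-- The projector of `⋀ⁿ⁺¹V_j` is dominated by that of `⋀ⁿ⁺¹V_{j+1}`. The difference projects onto a
complement, and wedging with the line orthogonal to `V_j` in `V_{j+1}` identifies `⋀ⁿV_j ⊗ L_j` with
it. -/
theorem wedgeClass_succ (r n : ℕ) (j : Fin (r + 1)) :
    wedgeClass r (n + 1) j.succ =
      wedgeClass r (n + 1) j.castSucc + wedgeClass r n j.castSucc * lineClass r j := by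
  have hle : ∀ x : CompleteFlag r, x.V j.castSucc ≤ x.V j.succ := fun x =>
    x.mono (Fin.castSucc_lt_succ).le
  have h1 : ∀ x (w : Space r), (spaceFamily r j.succ).e x ((spaceFamily r j.castSucc).e x w) =
      (spaceFamily r j.castSucc).e x w := fun x w => starProjection_starProjection_of_ge (hle x) w
  have h2 : ∀ x (w : Space r), (spaceFamily r j.castSucc).e x ((spaceFamily r j.succ).e x w) =
      (spaceFamily r j.castSucc).e x w := fun x w => starProjection_starProjection_of_le (hle x) w
  have hL : ∀ x w, (lineFamily r j).e x w =
      (spaceFamily r j.succ).e x w - (spaceFamily r j.castSucc).e x w := fun _ _ => rfl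
  have h3 : ∀ n x w, (wedgeFamily r n j.succ).e x ((wedgeFamily r n j.castSucc).e x w) =
      (wedgeFamily r n j.castSucc).e x w := fun n x w => by
    change exteriorPower.map _ _ (exteriorPower.map _ _ w) = exteriorPower.map _ _ w
    rw [← LinearMap.comp_apply, ← exteriorPower.map_comp]
    congr 2
    ext v : 1
    exact h1 x v
  have h4 : ∀ n x w, (wedgeFamily r n j.castSucc).e x ((wedgeFamily r n j.succ).e x w) =
      (wedgeFamily r n j.castSucc).e x w := fun n x w => by
    change exteriorPower.map _ _ (exteriorPower.map _ _ w) = exteriorPower.map _ _ w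
    rw [← LinearMap.comp_apply, ← exteriorPower.map_comp]
    congr 2
    ext v : 1
    exact h2 x v
  have key := (wedgeFamily r (n + 1) j.succ).kClass_diff (wedgeFamily r (n + 1) j.castSucc) rfl
    (h3 (n + 1)) (h4 (n + 1))
  refine key.trans (congrArg (wedgeClass r (n + 1) j.castSucc + ·) ?_)
  refine IdempotentFamily.kClass_mul _ _ _ (wedgeMul (Space r) n) ?_ ?_ (lineFamily_rank r j) ?_ ?_
  · intro g v w
    exact (map_wedgeMul n _ v w).symm
  · intro x v w
    -- On a product of an element of `⋀ⁿV_j` and a vector of the line, the first projector is the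
    -- identity and the second is zero, because the projector onto `V_j` kills the line.
    change exteriorPower.map _ _ _ - exteriorPower.map _ _ _ = _
    rw [map_wedgeMul, map_wedgeMul]
    have e1 : (spaceFamily r j.succ).e x ((lineFamily r j).e x w) = (lineFamily r j).e x w := by
      rw [hL, map_sub, h1, (spaceFamily r j.succ).idem]
    have e2 : (spaceFamily r j.castSucc).e x ((lineFamily r j).e x w) = 0 := by
      rw [hL, map_sub, h2, (spaceFamily r j.castSucc).idem, sub_self]
    rw [e1, e2, map_zero, sub_zero]
    exact congrArg (fun ω => wedgeMul (Space r) n ω _) (h3 n x v)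
  · change (j.succ : ℕ).choose (n + 1) - (j.castSucc : ℕ).choose (n + 1) =
      (j.castSucc : ℕ).choose n
    rw [Fin.val_succ, Fin.val_castSucc, Nat.choose_succ_succ, Nat.add_sub_cancel]
  · intro x v w hw h
    -- The functional is the inner product with the vector of the line itself: it vanishes on `V_j`
    -- by orthogonality, and on that vector it is the square of the norm.
    refine map_eq_zero_of_wedgeMul_eq_zero n _ (innerₛₗ ℂ ((lineFamily r j).e x w)) ?_ _ ?_ v h
    · intro u
      change inner ℂ _ ((x.V j.castSucc).starProjection u) = 0
      rw [← Submodule.inner_starProjection_left_eq_right]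
      have e2 : (x.V j.castSucc).starProjection ((lineFamily r j).e x w) = 0 := by
        change (spaceFamily r j.castSucc).e x _ = 0
        rw [hL, map_sub, h2, (spaceFamily r j.castSucc).idem, sub_self]
      rw [e2, inner_zero_left]
    · exact inner_self_ne_zero.2 hw

theorem wedgeClass_eq_zero (r n : ℕ) (j : Fin (r + 2)) (h : (j : ℕ) < n) :
    wedgeClass r n j = 0 := by
  refine IdempotentFamily.kClass_eq_zero _ fun x w => ?_
  have h1 := (wedgeFamily r n j).finrank_range x
  have h2 : LinearMap.range ((wedgeFamily r n j).e x) = ⊥ :=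
    Submodule.finrank_eq_zero.1 (h1.trans (Nat.choose_eq_zero_of_lt h))
  exact LinearMap.congr_fun (LinearMap.range_eq_bot.1 h2) w

theorem val_hopf (r : ℕ) (i : Fin r) :
    (hopf r i : EquivariantK (SymGroup r) (CompleteFlag r)) =
      wedgeClass r (i + 1) i.succ.castSucc := by
  -- The two families have the same projectors and the same action; only the ranks, `1` and a
  -- binomial coefficient, are written differently.
  have key : ∀ P Q : IdempotentFamily (SymGroup r) (CompleteFlag r) (⋀[ℂ]^(i + 1 : ℕ) (Space r)),
      P.rank = Q.rank → P.ρ = Q.ρ → P.e = Q.e → P = Q := by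
    rintro ⟨_, _, _, _, _, _, _, _⟩ ⟨_, _, _, _, _, _, _, _⟩ h1 h2 h3
    cases h1
    cases h2
    cases h3
    rfl
  change kClass (pluckerFamily r i).bundle = kClass (wedgeFamily r (i + 1) i.succ.castSucc).bundle
  rw [key (pluckerFamily r i) (wedgeFamily r (i + 1) i.succ.castSucc) ?_ rfl rfl]
  exact (Nat.choose_self (i + 1)).symm

end Flags

/-! ### Classes of trivial bundles and characters -/

theorem fromK_trivialBundle (r : ℕ) {n : ℕ} (ρ : Representation ℂ (SymGroup r) (Fin n → ℂ))
    (hρ : ∀ w, Continuous fun g => ρ g w) (a : Fin n → ℤ) (m : Fin n → Fin (r + 1) → ℤ)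
    (h : HasCharacter r ρ a m) :
    fromK r (kClass (trivialBundle (CompleteFlag r) ρ hρ)) =
      scalar r (∑ k, qVar r ^ a k * ∏ j, lam r j ^ m k j) :=
  Ideal.Quotient.eq.2 (Ideal.subset_span ⟨n, ρ, hρ, a, m, h, rfl⟩)

/-- The class of a trivial bundle is given by the weights of a basis of weight vectors. -/
theorem fromK_eq_of_weights (r : ℕ) {W ι : Type} [AddCommGroup W] [Module ℂ W]
    [FiniteDimensional ℂ W] [TopologicalSpace W] [IsModuleTopology ℂ W] [Fintype ι]
    (P : IdempotentFamily (SymGroup r) (CompleteFlag r) W) (he : ∀ x w, P.e x w = w)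
    (B : Module.Basis ι ℂ W) (m : ι → Fin (r + 1) → ℤ)
    (hB : ∀ (g : SymGroup r) (u : Fin (r + 1) → Circle),
      (g.2 : Matrix (Fin (r + 1)) (Fin (r + 1)) ℂ) = Matrix.diagonal (fun j => ((u j)⁻¹ : ℂ)) →
      ∀ i, P.ρ g (B i) = (∏ j, (u j : ℂ) ^ m i j) • B i) :
    fromK r (kClass P.bundle) = scalar r (∑ i, ∏ j, lam r j ^ m i j) := by
  classical
  let ε := Fintype.equivFin ι
  let φ : W ≃ₗ[ℂ] (Fin (Fintype.card ι) → ℂ) := (B.reindex ε).equivFun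
  let ρ : Representation ℂ (SymGroup r) (Fin (Fintype.card ι) → ℂ) :=
    { toFun := fun g => φ.conj (P.ρ g)
      map_one' := by rw [map_one]; exact φ.conj_id
      map_mul' := fun g h => by rw [map_mul]; exact φ.conj_comp _ _ }
  have hρ : ∀ w, Continuous fun g => ρ g w := fun w =>
    (IsModuleTopology.continuous_of_linearMap φ.toLinearMap).comp (P.continuous_ρ (φ.symm w))
  rw [P.kClass_eq_trivialBundle he ρ hρ φ fun g w => by
    change φ (P.ρ g w) = φ (P.ρ g (φ.symm (φ w)))
    rw [LinearEquiv.symm_apply_apply]]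
  -- The weights do not involve the circle factor, so all exponents of `q` are zero.
  rw [fromK_trivialBundle r ρ hρ (fun _ => 0) (fun k => m (ε.symm k)) ?_]
  · simp only [zpow_zero, one_mul]
    rw [ε.symm.sum_comp fun i => ∏ j, lam r j ^ m i j]
  · intro g u hg
    change LinearMap.trace ℂ _ (φ.conj (P.ρ g)) = _
    simp only [zpow_zero, one_mul]
    rw [LinearMap.trace_conj', LinearMap.trace_eq_matrix_trace ℂ B,
      ε.symm.sum_comp fun i => ∏ j, (u j : ℂ) ^ m i j]
    refine Finset.sum_congr rfl fun i _ => ?_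
    rw [Matrix.diag_apply, LinearMap.toMatrix_apply, hB g u hg]
    simp

theorem suIsometry_basis (r : ℕ) (g : Matrix.specialUnitaryGroup (Fin (r + 1)) ℂ)
    (c : Fin (r + 1) → ℂ) (hg : (g : Matrix (Fin (r + 1)) (Fin (r + 1)) ℂ) = Matrix.diagonal c)
    (i : Fin (r + 1)) :
    suIsometry r g ((EuclideanSpace.basisFun (Fin (r + 1)) ℂ).toBasis i) =
      c i • (EuclideanSpace.basisFun (Fin (r + 1)) ℂ).toBasis i := by
  rw [suIsometry_apply, hg]
  ext k
  by_cases h : k = i <;> simp [Matrix.mulVec_diagonal, h]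

/-- Wedge products of standard basis vectors over `n`-subsets `s` are weight vectors, of weight
`∏_{i ∈ s} Λ_i⁻¹`. The hypothesis, that the bundle fills the whole trivial bundle, is needed for `n
= 0` and for the full space. -/
theorem fromK_wedgeClass (r n : ℕ) (j : Fin (r + 2))
    (he : ∀ x w, (wedgeFamily r n j).e x w = w) :
    fromK r (wedgeClass r n j) =
      scalar r (∑ s ∈ Finset.powersetCard n Finset.univ, ∏ i ∈ s, (lam r i)⁻¹) := by
  classical
  let b := (EuclideanSpace.basisFun (Fin (r + 1)) ℂ).toBasis
  have hmem : ∀ s : Finset (Fin (r + 1)),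
      s ∈ Finset.powersetCard n Finset.univ ↔ s ∈ Set.powersetCard (Fin (r + 1)) n := fun s => by
    simp [Set.powersetCard.mem_iff]
  have h := fromK_eq_of_weights r (wedgeFamily r n j) he (b.exteriorPower n)
    (fun s i => if i ∈ s.1 then -1 else 0) ?_
  · refine h.trans (congrArg _ ?_)
    rw [Finset.sum_subtype _ hmem]
    refine Finset.sum_congr rfl fun s _ => ?_
    rw [← Finset.prod_subset (Finset.subset_univ s.1)]
    · exact Finset.prod_congr rfl fun i hi => by simp [hi]
    · intro i _ hi
      simp [hi]
  · intro g u hg s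
    have h1 : (wedgeFamily r n j).ρ g (b.exteriorPower n s) =
        (∏ k, ((u (Set.powersetCard.ofFinEmbEquiv.symm s k))⁻¹ : ℂ)) • b.exteriorPower n s := by
      rw [exteriorPower.basis_apply, exteriorPower.ιMulti_family]
      change exteriorPower.map n _ _ = _
      rw [exteriorPower.map_apply_ιMulti, ← AlternatingMap.map_smul_univ]
      congr 1
      funext k
      exact suIsometry_basis r g.2 _ hg _
    rw [h1]
    congr 1
    rw [← Finset.prod_subset (Finset.subset_univ s.1)]
    · rw [← Finset.prod_image (s := Finset.univ)
        (g := fun k => Set.powersetCard.ofFinEmbEquiv.symm s k)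
        (f := fun i => ((u i)⁻¹ : ℂ)) fun a _ b _ h =>
          (Set.powersetCard.ofFinEmbEquiv.symm s).injective h]
      have h2 : Finset.univ.image (fun k => Set.powersetCard.ofFinEmbEquiv.symm s k) = s.1 := by
        ext i
        rw [Finset.mem_image]
        simp only [Finset.mem_univ, true_and]
        exact Set.powersetCard.mem_range_ofFinEmbEquiv_symm_iff_mem s i
      rw [h2]
      exact Finset.prod_congr rfl fun i hi => by simp [hi]
    · intro i _ hi
      simp [hi]

/-- The class of `V_{j+1} / V_j` in the coefficient ring. -/
def lineElem (r : ℕ) (j : Fin (r + 1)) : CoeffRing r := fromK r (lineClass r j)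

theorem exteriorPower_map_zero {M : Type} [AddCommGroup M] [Module ℂ M] (f : M →ₗ[ℂ] M) :
    exteriorPower.map 0 f = LinearMap.id := by
  refine exteriorPower.linearMap_ext ?_
  ext m
  simp

theorem fromK_wedgeClass_zero (r : ℕ) (j : Fin (r + 2)) : fromK r (wedgeClass r 0 j) = 1 := by
  rw [fromK_wedgeClass]
  · simp
  · intro x w
    exact LinearMap.congr_fun (exteriorPower_map_zero _) w

theorem fromK_wedgeClass_last (r n : ℕ) :
    fromK r (wedgeClass r n (Fin.last (r + 1))) =
      scalar r (∑ s ∈ Finset.powersetCard n Finset.univ, ∏ i ∈ s, (lam r i)⁻¹) := by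
  refine fromK_wedgeClass r n _ fun x w => ?_
  have h1 : x.V (Fin.last (r + 1)) = ⊤ :=
    Submodule.eq_top_of_finrank_eq (by rw [x.finrank_eq]; simp)
  have h2 : (spaceFamily r (Fin.last (r + 1))).e x = LinearMap.id := by
    ext v : 1
    exact Submodule.starProjection_eq_self_iff.2 (h1 ▸ Submodule.mem_top)
  change exteriorPower.map n _ w = w
  rw [h2, exteriorPower.map_id]
  rfl

/-! ### The identity `∏(1 + L_j X) = ∏(1 + Λ_j⁻¹ X)` and the ratios `p_{j+1}/p_j` -/

open Polynomial

theorem coeff_prod_one_add {R ι : Type*} [CommRing R] (s : Finset ι) (y : ι → R) (n : ℕ) :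
    (∏ i ∈ s, (1 + C (y i) * X)).coeff n = ∑ t ∈ s.powersetCard n, ∏ i ∈ t, y i := by
  classical
  rw [Finset.prod_one_add, finsetSum_coeff, Finset.powersetCard_eq_filter, Finset.sum_filter]
  refine Finset.sum_congr rfl fun t _ => ?_
  rw [Finset.prod_mul_distrib, Finset.prod_const, ← map_prod, coeff_C_mul_X_pow]
  exact if_congr eq_comm rfl rfl

/-- Passing from `V_k` to `V_{k+1}` multiplies the generating polynomial of exterior powers by `1 +
L_k X`; `wedgeClass_succ` is this statement coefficient by coefficient. -/
theorem coeff_prod_lineElem (r : ℕ) (j : Fin (r + 2)) (n : ℕ) :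
    (∏ i ∈ Finset.univ.filter (fun i : Fin (r + 1) => i.castSucc < j), (1 + C (lineElem r i) * X)).coeff n =
      fromK r (wedgeClass r n j) := by
  induction j using Fin.induction generalizing n with
  | zero =>
    rw [Finset.filter_false_of_mem (by simp), Finset.prod_empty]
    cases n with
    | zero => rw [fromK_wedgeClass_zero, coeff_one_zero]
    | succ n => rw [wedgeClass_eq_zero r (n + 1) 0 (by simp), map_zero, coeff_one]; simp
  | succ k ih =>
    have h : (Finset.univ.filter fun i : Fin (r + 1) => i.castSucc < k.succ) =
        insert k (Finset.univ.filter fun i : Fin (r + 1) => i.castSucc < k.castSucc) := by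
      ext i
      simp [Fin.castSucc_lt_succ_iff, le_iff_eq_or_lt]
    rw [h, Finset.prod_insert (by simp)]
    cases n with
    | zero =>
      rw [fromK_wedgeClass_zero, mul_coeff_zero, ih, fromK_wedgeClass_zero]
      simp
    | succ n =>
      rw [add_mul, one_mul, coeff_add, mul_assoc, coeff_C_mul, coeff_X_mul, ih, ih,
        wedgeClass_succ, map_add, map_mul, lineElem, mul_comm (fromK r (lineClass r k))]

theorem esymm_lineElem (r n : ℕ) :
    ∑ s ∈ Finset.powersetCard n Finset.univ, ∏ i ∈ s, lineElem r i =
      scalar r (∑ s ∈ Finset.powersetCard n Finset.univ, ∏ i ∈ s, (lam r i)⁻¹) := by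
  rw [← fromK_wedgeClass_last, ← coeff_prod_lineElem, ← coeff_prod_one_add,
    Finset.filter_true_of_mem fun i _ => Fin.castSucc_lt_last i]

theorem prod_one_add_lineElem (r : ℕ) :
    ∏ j, (1 + C (lineElem r j) * X) = ∏ j, (1 + C (scalar r (lam r j)⁻¹) * X) := by
  ext n
  rw [coeff_prod_one_add, coeff_prod_one_add, esymm_lineElem, map_sum]
  exact Finset.sum_congr rfl fun s _ => map_prod _ _ _

theorem sum_lineElem (r : ℕ) : ∑ j, lineElem r j = eigenvalue r := by
  have h := esymm_lineElem r 1
  rw [eigenvalue, map_sum]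
  simpa [Finset.powersetCard_one] using h

theorem prod_lam (r : ℕ) : ∏ j, lam r j = 1 := by
  rw [Fin.prod_univ_succ]
  refine inv_mul_cancel₀ (Finset.prod_ne_zero_iff.2 fun i _ => ?_)
  simp

/-- The determinant has character `(Λ₀ ⋯ Λ_r)⁻¹ = 1`. This is what justifies the convention `p_{r+1}
= 1`. -/
theorem fromK_wedgeClass_top (r : ℕ) : fromK r (wedgeClass r (r + 1) (Fin.last (r + 1))) = 1 := by
  have h : Finset.powersetCard (r + 1) (Finset.univ : Finset (Fin (r + 1))) = {Finset.univ} := by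
    simpa using Finset.powersetCard_self (Finset.univ : Finset (Fin (r + 1)))
  rw [fromK_wedgeClass_last, h, Finset.sum_singleton, Finset.prod_inv_distrib, prod_lam, inv_one,
    map_one]

theorem val_p (r : ℕ) (i : Fin r) :
    (p r i : CoeffRing r) = fromK r (wedgeClass r (i + 1) i.succ.castSucc) :=
  congrArg (fromK r) (val_hopf r i)

theorem val_snoc_p (r : ℕ) (j : Fin (r + 1)) :
    ((Fin.snoc (α := fun _ => (CoeffRing r)ˣ) (p r) 1 j : (CoeffRing r)ˣ) : CoeffRing r) =
      fromK r (wedgeClass r (j + 1) j.succ) := by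
  induction j using Fin.lastCases with
  | last => rw [Fin.snoc_last]; exact (fromK_wedgeClass_top r).symm
  | cast i => rw [Fin.snoc_castSucc, val_p]; rfl

theorem val_cons_p (r : ℕ) (j : Fin (r + 1)) :
    ((Fin.cons (α := fun _ => (CoeffRing r)ˣ) 1 (p r) j : (CoeffRing r)ˣ) : CoeffRing r) =
      fromK r (wedgeClass r j j.castSucc) := by
  induction j using Fin.cases with
  | zero => rw [Fin.cons_zero]; exact (fromK_wedgeClass_zero r _).symm
  | succ i => rw [Fin.cons_succ, val_p]; rfl

/-- In `wedgeClass_succ` for the top exterior power of `V_{j+1}`, the term `⋀^{j+1}V_j` vanishes for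
dimension reasons, which leaves `p_{j+1} = p_j L_j`. -/
theorem step_p (r : ℕ) (j : Fin (r + 1)) : (step (p r) j : CoeffRing r) = lineElem r j := by
  rw [step, div_eq_mul_inv, Units.val_mul, Units.mul_inv_eq_iff_eq_mul, val_snoc_p, val_cons_p,
    wedgeClass_succ, wedgeClass_eq_zero r (j + 1) j.castSucc (by simp), zero_add, map_mul,
    lineElem, mul_comm]

theorem sum_step_p (r : ℕ) : ∑ j, (step (p r) j : CoeffRing r) = eigenvalue r := by
  simp_rw [step_p, sum_lineElem]

/-! ### Linear independence of the `Λ_k⁻¹` over `ℤ[q]` -/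

/-- The monomial `Λ_k⁻¹ ∏ᵢ Λᵢ` in the free coordinates `Λ₁, …, Λ_r`. -/
def clearedMonomial (r : ℕ) : Fin (r + 1) → MvPolynomial (Option (Fin r)) ℚ :=
  Fin.cons ((∏ i : Fin r, MvPolynomial.X (some i)) ^ 2)
    fun i => ∏ l ∈ Finset.univ.erase i, MvPolynomial.X (some l)

theorem algebraMap_clearedMonomial (r : ℕ) (k : Fin (r + 1)) :
    algebraMap _ (TorusField r) (clearedMonomial r k) =
      (lam r k)⁻¹ * algebraMap (MvPolynomial (Option (Fin r)) ℚ) (TorusField r)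
        (∏ i : Fin r, MvPolynomial.X (some i)) := by
  induction k using Fin.cases with
  | zero => simp [clearedMonomial, lam, pow_two]
  | succ i =>
    rw [← Finset.mul_prod_erase Finset.univ _ (Finset.mem_univ i), map_mul, ← mul_assoc]
    change _ = (algebraMap (MvPolynomial (Option (Fin r)) ℚ) (TorusField r) (MvPolynomial.X (some i)))⁻¹ * _ * _
    rw [inv_mul_cancel₀ (by simp), one_mul]
    rfl

/-- The weight of `clearedMonomial r k` when `Λ_{i+1}` has weight `i + 1`. -/
def clearedWeight (r : ℕ) : Fin (r + 1) → ℕ :=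
  Fin.cons ((∑ i : Fin r, ((i : ℕ) + 1)) * 2) fun i => ∑ l ∈ Finset.univ.erase i, ((l : ℕ) + 1)

/-- With `S = 1 + ⋯ + r` the weights are `2S` and `S - 1, …, S - r`, which are distinct. -/
theorem clearedWeight_injective (r : ℕ) : Function.Injective (clearedWeight r) := by
  have h : ∀ i : Fin r, ((i : ℕ) + 1) + clearedWeight r i.succ = ∑ i : Fin r, ((i : ℕ) + 1) :=
    fun i => Finset.add_sum_erase Finset.univ (fun l : Fin r => (l : ℕ) + 1) (Finset.mem_univ i)
  have h0 : clearedWeight r 0 = (∑ i : Fin r, ((i : ℕ) + 1)) * 2 := rfl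
  intro k l hkl
  induction k using Fin.cases with
  | zero =>
    induction l using Fin.cases with
    | zero => rfl
    | succ j => have := h j; omega
  | succ i =>
    induction l using Fin.cases with
    | zero => have := h i; omega
    | succ j =>
      have h1 := h i
      have h2 := h j
      exact congrArg Fin.succ (Fin.ext (by omega))

/-- The functions `Λ₀⁻¹, …, Λ_r⁻¹` are linearly independent over the integral polynomials in
`q`. -/
theorem eq_zero_of_sum_lam_inv (r : ℕ) (c : Fin (r + 1) → ℤ[X])
    (h : ∑ k, (lam r k)⁻¹ * aeval (qVar r) (c k) = 0) : c = 0 := by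
  let A := MvPolynomial (Option (Fin r)) ℚ
  have h1 : ∑ k, clearedMonomial r k * aeval (MvPolynomial.X none : A) (c k) = 0 := by
    -- Multiplication by `Λ₁ ⋯ Λ_r` clears all denominators.
    apply IsFractionRing.injective A (TorusField r)
    rw [map_sum, map_zero, ← zero_mul (algebraMap A (TorusField r)
      (∏ i : Fin r, MvPolynomial.X (some i))), ← h, Finset.sum_mul]
    refine Finset.sum_congr rfl fun k _ => ?_
    have h2 : algebraMap A (TorusField r) (aeval (MvPolynomial.X none : A) (c k)) =
        aeval (qVar r) (c k) := by
      rw [aeval_def, aeval_def, hom_eval₂]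
      congr 1
      exact Subsingleton.elim _ _
    rw [map_mul, algebraMap_clearedMonomial, h2]
    ring
  -- Substituting `X^{i+1}` for `Λ_{i+1}` and keeping `q` as the inner variable turns the monomials
  -- into distinct powers of `X`, whose coefficients can be read off separately.
  let ev : A →+* ℚ[X][X] := MvPolynomial.eval₂Hom (C.comp C)
    fun o => o.elim (C X) fun i => X ^ ((i : ℕ) + 1)
  have hX : ∀ o, ev (MvPolynomial.X o) = o.elim (C X) fun i => X ^ ((i : ℕ) + 1) :=
    fun o => MvPolynomial.eval₂Hom_X' _ _ _
  have hev : ∀ k, ev (clearedMonomial r k) = X ^ clearedWeight r k := fun k => by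
    induction k using Fin.cases with
    | zero =>
      simp [clearedMonomial, clearedWeight, hX, map_prod, Finset.prod_pow_eq_pow_sum, pow_mul]
    | succ i => simp [clearedMonomial, clearedWeight, hX, map_prod, Finset.prod_pow_eq_pow_sum]
  have hq : ∀ f : ℤ[X], ev (aeval (MvPolynomial.X none : A) f) =
      C (f.map (Int.castRingHom ℚ)) := fun f => by
    rw [aeval_def, hom_eval₂, Polynomial.map, hom_eval₂, hX]
    congr 1
    exact Subsingleton.elim _ _
  have h5 := congrArg ev h1
  simp only [map_sum, map_mul, hev, hq, map_zero] at h5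
  funext k
  have h6 := congrArg (fun f : ℚ[X][X] => f.coeff (clearedWeight r k)) h5
  simp only [finsetSum_coeff, mul_comm (X ^ _), coeff_C_mul_X_pow, coeff_zero,
    (clearedWeight_injective r).eq_iff] at h6
  refine (Polynomial.map_eq_zero_iff (Int.cast_injective (α := ℚ))).1 (?_ :
    (c k).map (Int.castRingHom ℚ) = 0)
  simpa using h6

/-! ### Invertibility of the recursion factor -/

/-- The difference `d_{j+1} - d_j`, with `d_0 = d_{r+1} = 0`. -/
def slope {r : ℕ} (d : Fin r →₀ ℕ) (j : Fin (r + 1)) : ℤ :=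
  Fin.snoc (α := fun _ => ℤ) (fun i => (d i : ℤ)) 0 j -
    Fin.cons (α := fun _ => ℤ) 0 (fun i => (d i : ℤ)) j

theorem step_exponent {r : ℕ} (d : Fin r →₀ ℕ) (j : Fin (r + 1)) :
    step (exponent d) j = step (p r) j * q r ^ slope d j := by
  have h1 : Fin.snoc (α := fun _ => (CoeffRing r)ˣ) (exponent d) 1 j =
      Fin.snoc (α := fun _ => (CoeffRing r)ˣ) (p r) 1 j *
        q r ^ Fin.snoc (α := fun _ => ℤ) (fun i => (d i : ℤ)) 0 j := by
    induction j using Fin.lastCases with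
    | last => simp
    | cast i => simp [exponent]
  have h2 : Fin.cons (α := fun _ => (CoeffRing r)ˣ) 1 (exponent d) j =
      Fin.cons (α := fun _ => (CoeffRing r)ˣ) 1 (p r) j *
        q r ^ Fin.cons (α := fun _ => ℤ) 0 (fun i => (d i : ℤ)) j := by
    induction j using Fin.cases with
    | zero => simp
    | succ i => simp [exponent]
  rw [step, step, h1, h2, slope, zpow_sub, mul_div_mul_comm, div_eq_mul_inv (q r ^ _)]

theorem eq_zero_of_slope_eq_zero {r : ℕ} (d : Fin r →₀ ℕ) (h : ∀ j, slope d j = 0) : d = 0 := by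
  have key : ∀ j : Fin (r + 1), Fin.cons (α := fun _ => ℤ) 0 (fun i => (d i : ℤ)) j = 0 := by
    intro j
    induction j using Fin.induction with
    | zero => rfl
    | succ i ih =>
      have h1 := h i.castSucc
      rw [slope, ih, Fin.snoc_castSucc] at h1
      rw [Fin.cons_succ]
      omega
  ext i
  have := key i.succ
  rw [Fin.cons_succ] at this
  exact_mod_cast this

/-- Linear independence is used twice: on the equality of sums, to see that `σ` is a permutation,
and then on the weighted sum, to see that each `q^{n_j}` is `1`. -/
theorem sum_permuted_lam_inv_ne_zero {r : ℕ} (σ : Fin (r + 1) → Fin (r + 1))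
    (hσ : ∑ j, (lam r (σ j))⁻¹ = ∑ j, (lam r j)⁻¹) (n : Fin (r + 1) → ℤ)
    (h : ∑ j, (lam r (σ j))⁻¹ * (qVar r ^ n j - 1) = 0) (j : Fin (r + 1)) : n j = 0 := by
  classical
  -- Comparing coefficients of `Λ_k⁻¹` shows that each fibre of `σ` has exactly one element.
  have hb : Function.Bijective σ := by
    have h1 := eq_zero_of_sum_lam_inv r
      (fun k => ((Finset.univ.filter fun j => σ j = k).card : ℤ[X]) - 1) (by
        simp only [map_sub, map_natCast, map_one, mul_sub, mul_one, Finset.sum_sub_distrib]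
        refine sub_eq_zero.2 (Eq.trans ?_ hσ)
        rw [← Finset.sum_fiberwise Finset.univ σ fun j => (lam r (σ j))⁻¹]
        refine Finset.sum_congr rfl fun k _ => ?_
        have h1 : ∀ j ∈ Finset.univ.filter (fun j => σ j = k), (lam r (σ j))⁻¹ = (lam r k)⁻¹ :=
          fun j hj => by rw [(Finset.mem_filter.1 hj).2]
        rw [Finset.sum_congr rfl h1, Finset.sum_const, nsmul_eq_mul, mul_comm])
    refine Function.Surjective.bijective_of_finite fun k => ?_
    have h2 := congrFun h1 k
    rw [Pi.zero_apply, sub_eq_zero] at h2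
    have h3 : (Finset.univ.filter fun j => σ j = k).card = 1 := by exact_mod_cast h2
    obtain ⟨j, hj⟩ := Finset.card_pos.1 (h3 ▸ Nat.one_pos)
    exact ⟨j, (Finset.mem_filter.1 hj).2⟩
  let τ := Equiv.ofBijective σ hb
  -- The exponents may be negative; multiplication by `q^N` makes all of them nonnegative, so that
  -- the coefficients are polynomials in `q`.
  let N : ℕ := ∑ j, (n j).natAbs
  have hN : ∀ j, 0 ≤ n j + N := fun j => by
    have : (n j).natAbs ≤ N := Finset.single_le_sum (f := fun j => (n j).natAbs)
      (fun _ _ => Nat.zero_le _) (Finset.mem_univ j)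
    omega
  have h1 := eq_zero_of_sum_lam_inv r
    (fun k => X ^ (n (τ.symm k) + N).toNat - X ^ N) (by
      rw [← τ.sum_comp]
      simp only [Equiv.symm_apply_apply, map_sub, map_pow, aeval_X]
      rw [← zero_mul (qVar r ^ N), ← h, Finset.sum_mul]
      refine Finset.sum_congr rfl fun j _ => ?_
      rw [← zpow_natCast _ (n j + N).toNat, Int.toNat_of_nonneg (hN j),
        zpow_add₀ (qVar_ne_zero r), zpow_natCast]
      change (lam r (σ j))⁻¹ * _ = _
      ring)
  have h2 := congrFun h1 (τ j)
  simp only [Equiv.symm_apply_apply, Pi.zero_apply, sub_eq_zero] at h2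
  have h3 := congrArg natDegree h2
  simp only [natDegree_X_pow] at h3
  have := hN j
  omega

/-- A nonunit lies in a maximal ideal, so it suffices to argue in a residue field. The field `ℚ(Λ,
q)` embeds there, and relations found in the residue field can be pulled back to it. -/
theorem isUnit_recursionFactor {r : ℕ} (d : Fin r →₀ ℕ) (hd : d ≠ 0) :
    IsUnit (recursionFactor d) := by
  by_contra hu
  obtain ⟨I, hI, hmem⟩ := exists_max_ideal_of_mem_nonunits hu
  let _ := Ideal.Quotient.field I
  let φ := Ideal.Quotient.mk I
  let ψ : TorusField r →+* CoeffRing r ⧸ I := φ.comp (scalar r)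
  have hψ : Function.Injective ψ := ψ.injective
  have hroot : ∀ j, ∃ k, φ (lineElem r j) = ψ (lam r k)⁻¹ := fun j => by
    have hne : φ (lineElem r j) ≠ 0 := by
      rw [← step_p]
      exact ((step (p r) j).isUnit.map φ).ne_zero
    -- At `X = -1/L_j`, legitimate because `L_j` is a unit, the left product vanishes; hence so does
    -- some factor `1 - Λ_k⁻¹/L_j` on the right.
    have h1 := congrArg (fun f => eval (-(φ (lineElem r j))⁻¹) (f.map φ))
      (prod_one_add_lineElem r)
    simp only [Polynomial.map_prod, eval_prod, Polynomial.map_add, Polynomial.map_one,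
      Polynomial.map_mul, map_C, map_X, eval_add, eval_one, eval_mul, eval_C, eval_X] at h1
    rw [Finset.prod_eq_zero (Finset.mem_univ j) (by field_simp; ring)] at h1
    obtain ⟨k, -, hk⟩ := Finset.prod_eq_zero_iff.1 h1.symm
    refine ⟨k, ?_⟩
    rw [mul_neg, ← sub_eq_add_neg, sub_eq_zero, ← div_eq_mul_inv, eq_div_iff hne, one_mul] at hk
    exact hk
  choose σ hσ using hroot
  have hsum : ∑ j, (lam r (σ j))⁻¹ = ∑ j, (lam r j)⁻¹ := by
    apply hψ
    rw [map_sum, ← Finset.sum_congr rfl fun j _ => hσ j, ← map_sum, sum_lineElem]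
    rfl
  refine hd (eq_zero_of_slope_eq_zero d fun j =>
    sum_permuted_lam_inv_ne_zero σ hsum (slope d) ?_ j)
  apply hψ
  have h0 : φ (recursionFactor d) = 0 := Ideal.Quotient.eq_zero_iff_mem.2 hmem
  rw [map_zero, ← h0, recursionFactor, map_sum, map_sum]
  refine Finset.sum_congr rfl fun j _ => ?_
  have hq : ((q r ^ slope d j : (CoeffRing r)ˣ) : CoeffRing r) =
      scalar r (qVar r ^ slope d j) := by
    rw [q, ← map_zpow, Units.coe_map]
    simp
  rw [step_exponent, Units.val_mul, hq, step_p, map_sub, map_mul, map_mul, ← hσ j, map_sub,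
    map_one]
  change _ * (φ (scalar r _) - 1) = _
  ring

/-! ### Coefficients of formal sums and the equivalence with the recursion -/

variable {r : ℕ}

theorem q_pow_injective [Nontrivial (CoeffRing r)] : Function.Injective fun n : ℕ => q r ^ n := by
  intro m n h
  have h1 : scalar r (qVar r ^ m) = scalar r (qVar r ^ n) := by
    have := congrArg Units.val h
    simpa [q] using this
  have h2 := (scalar r).injective h1
  rw [qVar, ← map_pow, ← map_pow] at h2
  have h3 := IsFractionRing.injective (MvPolynomial (Option (Fin r)) ℚ) (TorusField r) h2
  have h4 := congrArg MvPolynomial.totalDegree h3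
  simpa [MvPolynomial.totalDegree_X_pow] using h4

/-- Thus distinct `d` give distinct terms of the formal sum, and the sum defining `dressed` has at
most one summand at each exponent. -/
theorem exponent_injective [Nontrivial (CoeffRing r)] :
    Function.Injective (exponent : (Fin r →₀ ℕ) → Fin r → (CoeffRing r)ˣ) := by
  intro d d' h
  ext i
  exact q_pow_injective (mul_left_cancel (congrFun h i))

theorem dressed_exponent [Nontrivial (CoeffRing r)] (J : MvPowerSeries (Fin r) (CoeffRing r))
    (d : Fin r →₀ ℕ) : dressed J (exponent d) = MvPowerSeries.coeff d J := by
  have h : {d' : Fin r →₀ ℕ | exponent d' = exponent d} = {d} := by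
    ext d'
    exact exponent_injective.eq_iff
  rw [dressed, h]
  exact finsum_mem_singleton

theorem dressed_eq_zero (J : MvPowerSeries (Fin r) (CoeffRing r)) (u : Fin r → (CoeffRing r)ˣ)
    (h : ∀ d, exponent d ≠ u) : dressed J u = 0 := by
  have h : {d' : Fin r →₀ ℕ | exponent d' = u} = ∅ := by
    ext d'
    simpa using h d'
  rw [dressed, h]
  exact finsum_mem_empty

theorem exponent_add_single (d : Fin r →₀ ℕ) (i : Fin r) :
    exponent (d + Finsupp.single i 1) = exponent d * Pi.mulSingle i (q r) := by
  funext k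
  by_cases h : k = i
  · subst h
    simp [exponent, pow_succ, mul_assoc]
  · simp [exponent, h]

theorem mulQ_dressed_exponent [Nontrivial (CoeffRing r)]
    (J : MvPowerSeries (Fin r) (CoeffRing r)) (d : Fin r →₀ ℕ) (i : Fin r) :
    mulQ i (dressed J) (exponent d) =
      if i ∈ d.support then MvPowerSeries.coeff (d - Finsupp.single i 1) J else 0 := by
  rw [mulQ]
  split_ifs with hi
  · have h1 : d - Finsupp.single i 1 + Finsupp.single i 1 = d :=
      tsub_add_cancel_of_le (Finsupp.single_le_iff.2
        (Nat.one_le_iff_ne_zero.2 (Finsupp.mem_support_iff.1 hi)))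
    conv_lhs => rw [← h1]
    rw [exponent_add_single, mul_div_cancel_right, dressed_exponent]
  -- If the exponent divided by `q` in place `i` were again of the form `p q^{d'}`, injectivity
  -- would give `d = d' + 𝟏_i`, so `d_i` would not be zero.
  · refine dressed_eq_zero J _ fun d' hd' => hi ?_
    rw [eq_div_iff_mul_eq', ← exponent_add_single] at hd'
    rw [← exponent_injective hd']
    simp

theorem mulQ_dressed_eq_zero (J : MvPowerSeries (Fin r) (CoeffRing r))
    (u : Fin r → (CoeffRing r)ˣ) (h : ∀ d, exponent d ≠ u) (i : Fin r) :
    mulQ i (dressed J) u = 0 := by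
  refine dressed_eq_zero J _ fun d hd => h (d + Finsupp.single i 1) ?_
  rw [exponent_add_single, hd, div_mul_cancel]

theorem toda_apply (c : FormalSum r) (u : Fin r → (CoeffRing r)ˣ) :
    toda c u = (∑ j, (step u j : CoeffRing r)) * c u -
      ∑ i : Fin r, (step u i.succ : CoeffRing r) * mulQ i c u := by
  simp only [toda, translate, Pi.add_apply, Finset.sum_apply, Pi.sub_apply, mul_sub,
    Finset.sum_sub_distrib]
  rw [Fin.sum_univ_succ, add_mul, Finset.sum_mul, add_sub_assoc]

/-- Both sides of the eigenvalue equation are supported on the exponents `p q^d`, so it is an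
equation for each `d`. The recursion factor arises by replacing the eigenvalue with `∑ p_{j+1}/p_j`.
-/
theorem isTodaEigenvector_iff (J : MvPowerSeries (Fin r) (CoeffRing r)) :
    IsTodaEigenvector J ↔ ∀ d : Fin r →₀ ℕ, recursionFactor d * MvPowerSeries.coeff d J =
      ∑ i ∈ d.support, (step (exponent d) i.succ : CoeffRing r) *
        MvPowerSeries.coeff (d - Finsupp.single i 1) J := by
  cases subsingleton_or_nontrivial (CoeffRing r) with
  -- Over the zero ring the exponents collide, but every equation holds.
  | inl h => exact iff_of_true (Subsingleton.elim _ _) fun d => Subsingleton.elim _ _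
  | inr h =>
    have key : ∀ d : Fin r →₀ ℕ, toda (dressed J) (exponent d) =
        eigenvalue r * dressed J (exponent d) ↔ recursionFactor d * MvPowerSeries.coeff d J =
        ∑ i ∈ d.support, (step (exponent d) i.succ : CoeffRing r) *
          MvPowerSeries.coeff (d - Finsupp.single i 1) J := fun d => by
      have h1 : ∑ i : Fin r, (step (exponent d) i.succ : CoeffRing r) *
          mulQ i (dressed J) (exponent d) =
          ∑ i ∈ d.support, (step (exponent d) i.succ : CoeffRing r) *
            MvPowerSeries.coeff (d - Finsupp.single i 1) J := by
        simp only [mulQ_dressed_exponent, mul_ite, mul_zero, Finset.sum_ite_mem,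
          Finset.univ_inter]
      rw [toda_apply, dressed_exponent, h1, recursionFactor, Finset.sum_sub_distrib, sum_step_p,
        sub_mul, sub_eq_iff_eq_add, sub_eq_iff_eq_add, add_comm (eigenvalue r * _)]
    refine ⟨fun hJ d => (key d).1 (congrFun hJ _), fun hJ => funext fun u => ?_⟩
    by_cases hu : ∃ d, exponent d = u
    · obtain ⟨d, rfl⟩ := hu
      exact (key d).2 (hJ d)
    · have hu' : ∀ d, exponent d ≠ u := fun d hd => hu ⟨d, hd⟩
      rw [toda_apply, dressed_eq_zero J u hu']
      simp [mulQ_dressed_eq_zero J u hu']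

/-! ### Solving the recursion by induction on the degree -/

theorem degree_sub_single_lt {d : Fin r →₀ ℕ} {i : Fin r} (hi : i ∈ d.support) :
    (d - Finsupp.single i 1).degree < d.degree := by
  have h1 : d - Finsupp.single i 1 + Finsupp.single i 1 = d :=
    tsub_add_cancel_of_le (Finsupp.single_le_iff.2
      (Nat.one_le_iff_ne_zero.2 (Finsupp.mem_support_iff.1 hi)))
  conv_rhs => rw [← h1]
  simp

/-- The solution of the recursion with value `1` at `d = 0`. -/
def solution (d : Fin r →₀ ℕ) : CoeffRing r :=
  -- For `d ≠ 0` this is a true inverse, by `isUnit_recursionFactor`. Summing over the subtype keeps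
  -- the proof of `d_i ≠ 0` needed for termination.
  if d = 0 then 1 else Ring.inverse (recursionFactor d) *
    ∑ i : d.support, (step (exponent d) i.1.succ : CoeffRing r) *
      solution (d - Finsupp.single i.1 1)
termination_by d.degree
decreasing_by exact degree_sub_single_lt i.2

/-- At `d = 0` the recursion therefore reads `0 = 0` and leaves the constant term free; the
normalization fixes it. -/
theorem recursionFactor_zero : recursionFactor (0 : Fin r →₀ ℕ) = 0 := by
  have h : exponent (0 : Fin r →₀ ℕ) = p r := by
    funext i
    simp [exponent]
  simp [recursionFactor, h]

theorem solution_recursion (d : Fin r →₀ ℕ) : recursionFactor d * solution d =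
    ∑ i ∈ d.support, (step (exponent d) i.succ : CoeffRing r) *
      solution (d - Finsupp.single i 1) := by
  by_cases hd : d = 0
  · simp [hd, recursionFactor_zero]
  · rw [solution, if_neg hd, Ring.mul_inverse_cancel_left _ _ (isUnit_recursionFactor d hd)]
    exact Finset.sum_coe_sort d.support fun i => (step (exponent d) i.succ : CoeffRing r) *
      solution (d - Finsupp.single i 1)

theorem eq_solution (a : (Fin r →₀ ℕ) → CoeffRing r) (h0 : a 0 = 1)
    (h : ∀ d : Fin r →₀ ℕ, recursionFactor d * a d =
      ∑ i ∈ d.support, (step (exponent d) i.succ : CoeffRing r) * a (d - Finsupp.single i 1))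
    (d : Fin r →₀ ℕ) : a d = solution d := by
  induction hn : d.degree using Nat.strong_induction_on generalizing d with
  | _ n ih =>
    by_cases hd : d = 0
    · rw [hd, h0, solution, if_pos rfl]
    · refine (isUnit_recursionFactor d hd).mul_left_cancel ?_
      rw [h, solution_recursion]
      refine Finset.sum_congr rfl fun i hi => ?_
      rw [ih _ (hn ▸ degree_sub_single_lt hi) _ rfl]

end

end FlagToda

open FlagToda
theorem corollary1 (r : ℕ) :
    (∀ J : MvPowerSeries (Fin r) (CoeffRing r), IsTodaEigenvector J ↔
      ∀ d : Fin r →₀ ℕ, recursionFactor d * MvPowerSeries.coeff d J =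
        ∑ i ∈ d.support, (step (exponent d) i.succ : CoeffRing r) *
          MvPowerSeries.coeff (d - Finsupp.single i 1) J) ∧
    (∀ d : Fin r →₀ ℕ, d ≠ 0 → IsUnit (recursionFactor (r := r) d)) ∧
    ∃! J : MvPowerSeries (Fin r) (CoeffRing r),
      IsTodaEigenvector J ∧ MvPowerSeries.constantCoeff J = 1 := by
  refine ⟨isTodaEigenvector_iff, isUnit_recursionFactor, fun d => solution d,
    ⟨(isTodaEigenvector_iff _).2 fun d => solution_recursion d, ?_⟩, ?_⟩
  · change solution 0 = 1
    rw [solution, if_pos rfl]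
  · rintro J ⟨hJ, h0⟩
    exact funext (eq_solution (fun d => MvPowerSeries.coeff d J) h0
      ((isTodaEigenvector_iff J).1 hJ))
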